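/- **Setting.** Let $r,n\ge 1$ be integers, $p\mid r$ and $e\mid p$. Let $G=G(r,p,n)\subseteq GL_n(\mathbb{C})$ be the group of all monomial matrices whose non-zero entries are $r$-th roots of unity with product an $\frac rp$-th root of unity. Let $\xi=\xi_{er/p}$ be a primitive $\frac{er}{p}$-th root of unity and $\gamma=\operatorname{diag}(\xi,1,\dots,1)$. Let $\zeta\in\mathbb{C}$ be a primitive $m$-th root of unity ($m\ge 1$), and $d=\frac{m}{\gcd(m,r)}$. For a matrix $x$ put $V(x,\zeta)=\{v\in\mathbb{C}^n: xv=\zeta v\}$, and let $\mathcal{S}_\zeta^V(\gamma G)=\{V(x,\zeta): x\in\gamma G\}$, ordered by reverse inclusion. **Dowling lattices.** For a finite group $H$, an $H$-prepartition of $[n]=\{1,\dots,n\}$ consists of a subset $I\subseteq[n]$ (the zero block), a partition $\pi$ of $[n]\setminus I$ into non-empty (nonzero) blocks, and a labelling $\lambda:[n]\setminus I\to H$. Two prepartitions are equivalent if they have the same $I$ and $\pi$, and on each nonzero block the two labellings differ by right multiplication by an element of $H$ (depending on the block). An $H$-partition is an equivalence class of $H$-prepartitions. The Dowling lattice $Q_n(H)$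 is the set of $H$-partitions, with the partial order generated by the following covering relation: $y$ covers $x$ if $y$ arises from $x$ either by merging one nonzero block into $I$, or by merging two nonzero blocks $B,C$ into the block $B\cup C$, keeping the labels on $B$ and multiplying those on $C$ on the right by some $g\in H$. Its minimum $\hat 0$ has $I=\emptyset$ and only singleton blocks. Write $Q_n(r)=Q_n(\mathbb{Z}/r\mathbb{Z})$. The following subposets of $Q_n(r)$ carry the induced order: * $Q_n(r,J)$, for $J\subseteq\{0,\dots,n\}$: the elements with $|I|\notin J$, together with $\hat 0$. * $Q_n(r,d)$: the elements all of whose nonzero blocks have size divisible by $d$, together with $\hat 0$. * $Q_n(r,d,k)$, for $k\mid r$ and $k\mid d$: the elements of $Q_n(r,d)$ such that, for each nonzero block $B$, the number $|\{a\in B:\lambda(a)\equiv j \pmod k\}|$ does not depend on $j$, together with $\hat 0$. * $Q_n(r,d,k,J)$: the elements of $Q_n(r,d,k)$ with $|I|\notin J$, together with $\hat 0$. $\Pi_n$ denotes the lattice of partitions of $[n]$ ordered by refinement, finer partitions being smaller. **Theorem.** 1. If $d>1$, $n\equiv 0\pmod d$ and $(\zeta^n\xi^{-1})^{r/p}\ne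 1$, then $\mathcal{S}_\zeta^V(\gamma G)\cong Q_n(dr,d,d,\{0\})\setminus\{\hat 0\}$. 2. If $d>1$ and the conditions of (1) are not satisfied, then $\mathcal{S}_\zeta^V(\gamma G)\cong Q_n(dr,d,d)\setminus\{\hat 0\}$. 3. If $d=1$ and $(\zeta^n\xi^{-1})^{r/p}\neq 1$, then $\mathcal{S}_\zeta^V(\gamma G)\cong Q_n(r,\{0\})\setminus\{\hat 0\}$. 4. If $d=1$, $r=p\ne 1$ and $\zeta^n=\xi$, then $\mathcal{S}_\zeta^V(\gamma G)\cong Q_n(r,\{1\})$. 5. If $d=1$ and $r=p=1$, then $m=1$ and $\mathcal{S}_\zeta^V(\gamma G)\cong Q_{n-1}(1)\cong\Pi_n$. 6. If $d=1$ and the conditions of (3), (4) and (5) are not satisfied, then $\mathcal{S}_\zeta^V(\gamma G)\cong Q_n(r)$. Here $\cong$ denotes isomorphism of partially ordered sets. -/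

import Mathlib

/-! ### The groups `G(r, p, n)` and posets of eigenspaces -/

/-- The matrix of the linear map `e_j ↦ θ_{σ(j)} e_{σ(j)}` of `ℂⁿ`. -/
def monomialMatrix {n : ℕ} (θ : Fin n → ℂˣ) (σ : Equiv.Perm (Fin n)) :
    Matrix (Fin n) (Fin n) ℂ :=
  Matrix.of fun i j => if i = σ j then (θ i : ℂ) else 0

theorem monomialMatrix_one {n : ℕ} :
    monomialMatrix (1 : Fin n → ℂˣ) 1 = 1 := by
  ext i j
  rw [Matrix.one_apply]
  by_cases h : i = j
  · simp [monomialMatrix, h]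
  · simp [monomialMatrix, h]

theorem monomialMatrix_mul {n : ℕ} (θ θ' : Fin n → ℂˣ) (σ σ' : Equiv.Perm (Fin n)) :
    monomialMatrix θ σ * monomialMatrix θ' σ' =
      monomialMatrix (fun i => θ i * θ' (σ⁻¹ i)) (σ * σ') := by
  ext i j
  simp only [monomialMatrix, Matrix.mul_apply, Matrix.of_apply]
  rw [Finset.sum_eq_single (σ' j)]
  · by_cases h : i = σ (σ' j)
    · simp [h]
    · simp [h]
  · intro b _ hb
    simp [hb]
  · simp

/-- The group `G(r, p, n)` (for `p ∣ r`): the monomial matrices whose nonzero entries are `r`-th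
roots of unity such that the product of the nonzero entries is an `r/p`-th root of unity. -/
def imprimitiveGroup (r p n : ℕ) : Subgroup (GL (Fin n) ℂ) where
  carrier := {g | ∃ (θ : Fin n → ℂˣ) (σ : Equiv.Perm (Fin n)),
    (∀ i, θ i ^ r = 1) ∧ (∏ i, θ i) ^ (r / p) = 1 ∧
      (g : Matrix (Fin n) (Fin n) ℂ) = monomialMatrix θ σ}
  one_mem' := ⟨1, 1, by simp, by simp, by simp [monomialMatrix_one]⟩
  mul_mem' := by
    rintro a b ⟨θ, σ, h1, h2, h3⟩ ⟨θ', σ', h1', h2', h3'⟩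
    refine ⟨fun i => θ i * θ' (σ⁻¹ i), σ * σ', ?_, ?_, ?_⟩
    · intro i
      simp [mul_pow, h1, h1']
    · rw [Finset.prod_mul_distrib, mul_pow, h2, one_mul, Equiv.prod_comp σ⁻¹ θ', h2']
    · rw [Units.val_mul, h3, h3', monomialMatrix_mul]
  inv_mem' := by
    rintro a ⟨θ, σ, h1, h2, h3⟩
    refine ⟨fun i => (θ (σ i))⁻¹, σ⁻¹, ?_, ?_, ?_⟩
    · intro i
      simp [h1]
    · rw [Finset.prod_inv_distrib, Equiv.prod_comp σ θ, inv_pow, h2, inv_one]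
    · apply Units.inv_eq_of_mul_eq_one_right
      rw [h3, monomialMatrix_mul, ← monomialMatrix_one]
      congr 1
      · ext i
        simp
      · simp

/-- The matrix `diag(ξ, 1, …, 1)`. -/
def diagFirst (n : ℕ) (ξ : ℂ) : Matrix (Fin n) (Fin n) ℂ :=
  Matrix.diagonal fun i => if (i : ℕ) = 0 then ξ else 1

/-- The coset `γ G`, as a set of matrices. -/
def matrixCoset {n : ℕ} (γ : Matrix (Fin n) (Fin n) ℂ) (G : Subgroup (GL (Fin n) ℂ)) :
    Set (Matrix (Fin n) (Fin n) ℂ) :=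
  {x | ∃ g ∈ G, x = γ * (g : Matrix (Fin n) (Fin n) ℂ)}

/-- The set of eigenspaces `V(x, ζ) = {v ∈ ℂⁿ | x v = ζ v}` with `x ∈ X`. It lives in the order
dual of the lattice of subspaces, so its order is the reverse of inclusion. -/
def eigenspacePoset {n : ℕ} (X : Set (Matrix (Fin n) (Fin n) ℂ)) (ζ : ℂ) :
    Set (Submodule ℂ (Fin n → ℂ))ᵒᵈ :=
  {U | ∃ x ∈ X, U = OrderDual.toDual (Module.End.eigenspace (Matrix.toLin' x) ζ)}

/-! ### Dowling lattices -/

/-- A `G`-prepartition of `[n]`: a zero block `I`, a partition of `[n] ∖ I` into nonempty nonzero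
blocks, and a labelling of the elements of the nonzero blocks by elements of `G`. The values of
`label` on the zero block are irrelevant: nothing below depends on them. -/
structure GPrepartition (n : ℕ) (G : Type*) where
  zero : Finset (Fin n)
  part : Finpartition zeroᶜ
  label : Fin n → G

namespace GPrepartition

variable {n : ℕ} {G : Type*} [Group G]

/-- Two prepartitions are equivalent if they have the same zero block and the same nonzero
blocks, and if on each nonzero block the labellings differ by a right translation. -/
instance setoid (n : ℕ) (G : Type*) [Group G] : Setoid (GPrepartition n G) where
  r P Q := P.zero = Q.zero ∧ P.part.parts = Q.part.parts ∧
    ∀ B ∈ P.part.parts, ∃ g : G, ∀ a ∈ B, Q.label a = P.label a * g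
  iseqv :=
    { refl := fun P => ⟨rfl, rfl, fun B _ => ⟨1, fun a _ => by simp⟩⟩
      symm := by
        rintro P Q ⟨h1, h2, h3⟩
        refine ⟨h1.symm, h2.symm, fun B hB => ?_⟩
        obtain ⟨g, hg⟩ := h3 B (h2 ▸ hB)
        exact ⟨g⁻¹, fun a ha => by simp [hg a ha]⟩
      trans := by
        rintro P Q R ⟨h1, h2, h3⟩ ⟨h1', h2', h3'⟩
        refine ⟨h1.trans h1', h2.trans h2', fun B hB => ?_⟩
        obtain ⟨g, hg⟩ := h3 B hB
        obtain ⟨g', hg'⟩ := h3' B (h2 ▸ hB)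
        exact ⟨g * g', fun a ha => by rw [hg' a ha, hg a ha, mul_assoc]⟩ }

/-- `Q` is obtained from `P` by merging two blocks: either a nonzero block `B` is merged into the
zero block, or two nonzero blocks `B`, `C` are merged into `B ∪ C · g` for some `g ∈ G`. -/
inductive Merge (P Q : GPrepartition n G) : Prop
  | zero (B : Finset (Fin n)) (hB : B ∈ P.part.parts)
      (hzero : Q.zero = P.zero ∪ B)
      (hparts : Q.part.parts = P.part.parts.erase B)
      (hlabel : ∀ a ∉ Q.zero, Q.label a = P.label a)
  | nonzero (B C : Finset (Fin n)) (hB : B ∈ P.part.parts) (hC : C ∈ P.part.parts)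
      (hne : B ≠ C) (g : G)
      (hzero : Q.zero = P.zero)
      (hparts : Q.part.parts = insert (B ∪ C) ((P.part.parts.erase B).erase C))
      (hlabel : ∀ a ∉ Q.zero, Q.label a = if a ∈ C then P.label a * g else P.label a)

theorem Merge.card_lt {P Q : GPrepartition n G} (h : Merge P Q) :
    Q.part.parts.card < P.part.parts.card := by
  cases h with
  | zero B hB _ hparts _ =>
    rw [hparts]
    exact Finset.card_erase_lt_of_mem hB
  | nonzero B C hB hC hne g _ hparts _ =>
    have hC' : C ∈ P.part.parts.erase B := Finset.mem_erase.2 ⟨hne.symm, hC⟩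
    have h1 := Finset.card_erase_add_one hB
    have h2 := Finset.card_erase_add_one hC'
    have h3 := Finset.card_insert_le (B ∪ C) ((P.part.parts.erase B).erase C)
    rw [hparts]
    omega

end GPrepartition

/-- The underlying set of the Dowling lattice `Q_n(G)`: the `G`-partitions, that is, the
equivalence classes of `G`-prepartitions. -/
def Dowling (n : ℕ) (G : Type*) [Group G] : Type _ :=
  Quotient (GPrepartition.setoid n G)

namespace Dowling

variable {n : ℕ} {G : Type*} [Group G]

/-- The `G`-partition represented by a `G`-prepartition. -/
def mk (P : GPrepartition n G) : Dowling n G :=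
  Quotient.mk (GPrepartition.setoid n G) P

/-- The zero block of a `G`-partition. -/
def zeroBlock (x : Dowling n G) : Finset (Fin n) :=
  Quotient.lift (s := GPrepartition.setoid n G) (fun P => P.zero) (fun _ _ h => h.1) x

/-- The underlying sets of the nonzero blocks of a `G`-partition. -/
def blocks (x : Dowling n G) : Finset (Finset (Fin n)) :=
  Quotient.lift (s := GPrepartition.setoid n G) (fun P => P.part.parts) (fun _ _ h => h.2.1) x

/-- The covering relation: `y` is obtained from `x` by merging two `G`-blocks. -/
def Covers (x y : Dowling n G) : Prop :=
  ∃ P Q : GPrepartition n G, mk P = x ∧ mk Q = y ∧ GPrepartition.Merge P Q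

theorem Covers.card_lt {x y : Dowling n G} (h : Covers x y) :
    y.blocks.card < x.blocks.card := by
  obtain ⟨P, Q, rfl, rfl, h⟩ := h
  exact h.card_lt

theorem card_le_of_reflTransGen {x y : Dowling n G} (h : Relation.ReflTransGen Covers x y) :
    y.blocks.card ≤ x.blocks.card := by
  induction h with
  | refl => exact le_rfl
  | tail _ h ih => exact h.card_lt.le.trans ih

/-- The partial order of `Q_n(G)` is the one generated by the covering relation. -/
instance : PartialOrder (Dowling n G) where
  le := Relation.ReflTransGen Covers
  le_refl _ := Relation.ReflTransGen.refl
  le_trans _ _ _ h h' := h.trans h'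
  le_antisymm x y h h' := by
    rcases Relation.ReflTransGen.cases_head h with rfl | ⟨z, hxz, hzy⟩
    · rfl
    · have h1 := hxz.card_lt
      have h2 := card_le_of_reflTransGen hzy
      have h3 := card_le_of_reflTransGen h'
      omega

/-- The minimum element `0̂` of `Q_n(G)`: the zero block is empty and all nonzero blocks are
singletons. -/
instance : Bot (Dowling n G) where
  bot := mk ⟨∅, ⊥, fun _ => 1⟩

end Dowling

/-- The Dowling lattice `Q_n(r)` of the cyclic group `μ_r`, identified with `ℤ/rℤ`. -/
abbrev DowlingCyclic (n r : ℕ) : Type :=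
  Dowling n (Multiplicative (ZMod r))

/-- `Q_n(r, J)`: the elements of `Q_n(r)` whose zero block has size not in `J`, together with the
minimum element. -/
def dowlingJ (n r : ℕ) (J : Set ℕ) : Set (DowlingCyclic n r) :=
  {x | x.zeroBlock.card ∉ J} ∪ {⊥}

/-- `Q_n(r, d)`: the elements of `Q_n(r)` whose nonzero blocks have size divisible by `d`,
together with the minimum element. -/
def dowlingDiv (n r d : ℕ) : Set (DowlingCyclic n r) :=
  {x | ∀ B ∈ x.blocks, d ∣ B.card} ∪ {⊥}

/-- The elements of `Q_n(r)` such that in each nonzero block the number of elements whose label is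
congruent to `j` modulo `k` does not depend on `j`. This is used only for `k ∣ r`, where
`ZMod.cast` is the reduction `ℤ/rℤ → ℤ/kℤ` and where the condition does not depend on the
representing prepartition. -/
def IsEvenlyColoured {n r : ℕ} (k : ℕ) (x : DowlingCyclic n r) : Prop :=
  ∃ P : GPrepartition n (Multiplicative (ZMod r)), Dowling.mk P = x ∧
    ∀ B ∈ P.part.parts, ∀ i j : ZMod k,
      (B.filter fun a => (ZMod.cast (Multiplicative.toAdd (P.label a)) : ZMod k) = i).card =
      (B.filter fun a => (ZMod.cast (Multiplicative.toAdd (P.label a)) : ZMod k) = j).card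

/-- `Q_n(r, d, k)` (for `k ∣ r` and `k ∣ d`): the `k`-evenly coloured elements of `Q_n(r, d)`,
together with the minimum element. -/
def dowlingDivEven (n r d k : ℕ) : Set (DowlingCyclic n r) :=
  {x | x ∈ dowlingDiv n r d ∧ IsEvenlyColoured k x} ∪ {⊥}

/-- `Q_n(r, d, k, J)`: the elements of `Q_n(r, d, k)` whose zero block has size not in `J`,
together with the minimum element. -/
def dowlingDivEvenJ (n r d k : ℕ) (J : Set ℕ) : Set (DowlingCyclic n r) :=
  {x | x ∈ dowlingDivEven n r d k ∧ x.zeroBlock.card ∉ J} ∪ {⊥}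

/-- The partition lattice `Π_n`, ordered by refinement (finer partitions are smaller). -/
abbrev PartitionLattice (n : ℕ) : Type :=
  Finpartition (Finset.univ : Finset (Fin n))

/-!
The proof identifies an eigenspace with a Dowling element.

Let `N = d r`, the least common multiple of `m` and `r`. A character `χ` that identifies `ℤ/N` with
the `N`-th roots of unity attaches to a prepartition `P` with labels in `ℤ/N` the subspace of the
vectors that vanish on the zero block and are proportional to `χ ∘ label` on each nonzero block.
This is an order embedding of `Q_n(N)` into the subspaces of `ℂⁿ` ordered by reverse inclusion
(`Dowling.subspaceEmbedding`): the order generated by merging blocks has an elementwise description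
(`Dowling.mk_le_mk`), which can be read off from vectors supported on a single block.

An element of `γ G` is a monomial matrix whose coefficients are `r`-th roots of unity with product
in `ξ μ_{r/p}`. The equation `x v = ζ v` decouples over the cycles of the permutation; on a cycle
an eigenvector is zero, or has no zeros and is unique up to a factor. In the second case the
coordinates, suitably normalized, are `N`-th roots of unity. The `r`-th roots of unity have label
`0` modulo `d` and `ζ` has a generator of `ℤ/d` as its label modulo `d`, so the labels modulo `d`
run through `ℤ/d` periodically along the cycle. So `V(x, ζ)` is the subspace of an evenly coloured
prepartition (`exists_prepartition_of_monomialMatrix`), and conversely an evenly coloured block can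
be ordered cyclically such that the colours behave like this
(`exists_monomialMatrix_of_prepartition`).

What remains is the zero block `I`. The product of the coefficients over the nonzero blocks is
`ζ ^ (n - |I|)`, and `I` must carry a monomial map without the eigenvalue `ζ` that brings the total
product into `ξ μ_{r/p}` (`ZeroBlockCondition`, `mem_eigenspacePoset_iff`). If `I` is empty, this
says `(ζ ^ n ξ⁻¹) ^ (r/p) = 1`. For `d > 1` fixed points never have the eigenvalue `ζ`, so that
each nonempty `I` is possible. For `d = 1` a single cycle on `I` only excludes the product
`ζ ^ |I|` on `I`, that is, the total product `ζ ^ n`. If `r = p` and `ζ ^ n = ξ`, precisely this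
product is required; it is attained with two cycles if `|I| ≥ 2` and `r > 1`, and it is impossible
if `|I| = 1` or `r = 1`. The cases of the theorem are the resulting sets of sizes of `I`. For
`r = p = 1` only `I = ∅` is left, which gives the lattice `Π_n`.
-/

/-! ### The order of the Dowling lattice -/

namespace GPrepartition

variable {n : ℕ} {G : Type*}

/-- Two elements of `[n]` lie in the same nonzero block. -/
def Same (P : GPrepartition n G) (i j : Fin n) : Prop :=
  ∃ B ∈ P.part.parts, i ∈ B ∧ j ∈ B

theorem Same.symm {P : GPrepartition n G} {i j : Fin n} (h : P.Same i j) : P.Same j i := by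
  obtain ⟨B, hB, hi, hj⟩ := h
  exact ⟨B, hB, hj, hi⟩

theorem Same.trans {P : GPrepartition n G} {i j k : Fin n} (h : P.Same i j) (h' : P.Same j k) :
    P.Same i k := by
  obtain ⟨B, hB, hi, hj⟩ := h
  obtain ⟨C, hC, hj', hk⟩ := h'
  obtain rfl := P.part.eq_of_mem_parts hB hC hj hj'
  exact ⟨B, hB, hi, hk⟩

theorem notMem_zero_of_mem_parts {P : GPrepartition n G} {B : Finset (Fin n)}
    (hB : B ∈ P.part.parts) {i : Fin n} (hi : i ∈ B) : i ∉ P.zero :=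
  Finset.mem_compl.1 (P.part.subset hB hi)

theorem Same.left {P : GPrepartition n G} {i j : Fin n} (h : P.Same i j) : i ∉ P.zero := by
  obtain ⟨B, hB, hi, -⟩ := h
  exact notMem_zero_of_mem_parts hB hi

theorem same_self {P : GPrepartition n G} {i : Fin n} : P.Same i i ↔ i ∉ P.zero := by
  refine ⟨Same.left, fun h => ?_⟩
  obtain ⟨B, hB, hi⟩ := P.part.exists_mem (Finset.mem_compl.2 h)
  exact ⟨B, hB, hi, hi⟩

theorem same_iff_mem {P : GPrepartition n G} {B : Finset (Fin n)} (hB : B ∈ P.part.parts)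
    {i j : Fin n} (hi : i ∈ B) : P.Same i j ↔ j ∈ B := by
  refine ⟨?_, fun hj => ⟨B, hB, hi, hj⟩⟩
  rintro ⟨C, hC, hi', hj⟩
  rwa [P.part.eq_of_mem_parts hB hC hi hi']

theorem parts_subset_of_same_iff {P Q : GPrepartition n G}
    (h : ∀ i j, P.Same i j ↔ Q.Same i j) : P.part.parts ⊆ Q.part.parts := by
  intro B hB
  obtain ⟨i, hi⟩ := P.part.nonempty_of_mem_parts hB
  obtain ⟨C, hC, hiC, -⟩ := (h i i).1 ⟨B, hB, hi, hi⟩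
  have : B = C := by
    ext j
    rw [← same_iff_mem hB hi, ← same_iff_mem hC hiC, h]
  rwa [this]

/-- The prepartition with a given zero block whose nonzero blocks are the classes of a given
equivalence relation outside the zero block. -/
noncomputable def ofSetoid (I : Finset (Fin n)) (s : Setoid (Fin n)) (l : Fin n → G) :
    GPrepartition n G :=
  open Classical in ⟨I, Finpartition.ofSetSetoid s Iᶜ, l⟩

theorem ofSetoid_same {I : Finset (Fin n)} {s : Setoid (Fin n)} {l : Fin n → G} {i j : Fin n} :
    (ofSetoid I s l).Same i j ↔ i ∉ I ∧ j ∉ I ∧ s i j := by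
  classical
  rw [← Finset.mem_compl, ← Finset.mem_compl (a := j),
    ← Finpartition.mem_part_ofSetSetoid_iff_rel (s := s) Iᶜ, Finpartition.mem_part_iff_exists]
  exact exists_congr fun B => and_congr_right fun _ => and_comm

variable [Group G]

/-- A description of the order of the Dowling lattice by elements of `[n]`: `Q` has a larger zero
block and unites blocks of `P`, without changing the quotient of the labels of two elements that
share a block of `P`, unless these elements end up in the zero block. -/
def Refines (P Q : GPrepartition n G) : Prop :=
  P.zero ⊆ Q.zero ∧ ∀ i j, P.Same i j → (i ∈ Q.zero ∧ j ∈ Q.zero) ∨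
    (Q.Same i j ∧ Q.label i * (Q.label j)⁻¹ = P.label i * (P.label j)⁻¹)

theorem Refines.trans {P Q R : GPrepartition n G} (h : P.Refines Q) (h' : Q.Refines R) :
    P.Refines R := by
  refine ⟨h.1.trans h'.1, fun i j hij => ?_⟩
  rcases h.2 i j hij with ⟨hi, hj⟩ | ⟨hij', e⟩
  · exact Or.inl ⟨h'.1 hi, h'.1 hj⟩
  · rcases h'.2 i j hij' with h'' | ⟨hij'', e'⟩
    · exact Or.inl h''
    · exact Or.inr ⟨hij'', e'.trans e⟩

theorem refines_of_equiv {P Q : GPrepartition n G} (h : P ≈ Q) : P.Refines Q := by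
  obtain ⟨h1, h2, h3⟩ := h
  refine ⟨h1.subset, fun i j hij => Or.inr ?_⟩
  obtain ⟨B, hB, hi, hj⟩ := hij
  obtain ⟨g, hg⟩ := h3 B hB
  exact ⟨⟨B, h2 ▸ hB, hi, hj⟩, by simp [hg i hi, hg j hj, mul_assoc]⟩

theorem equiv_of_same_iff {P Q : GPrepartition n G} (h0 : P.zero = Q.zero)
    (h : ∀ i j, P.Same i j ↔ Q.Same i j)
    (hl : ∀ i j, P.Same i j → Q.label i * (Q.label j)⁻¹ = P.label i * (P.label j)⁻¹) :
    P ≈ Q := by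
  refine ⟨h0, (parts_subset_of_same_iff h).antisymm
    (parts_subset_of_same_iff fun i j => (h i j).symm), fun B hB => ?_⟩
  obtain ⟨i, hi⟩ := P.part.nonempty_of_mem_parts hB
  refine ⟨(P.label i)⁻¹ * Q.label i, fun a ha => ?_⟩
  rw [← mul_assoc, ← hl a i ⟨B, hB, ha, hi⟩]
  simp

theorem Merge.refines {P Q : GPrepartition n G} (h : Merge P Q) : P.Refines Q := by
  cases h with
  | zero B hB hzero hparts hlabel =>
    refine ⟨hzero ▸ Finset.subset_union_left, ?_⟩
    rintro i j ⟨C, hC, hi, hj⟩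
    by_cases hCB : C = B
    · subst hCB
      exact Or.inl ⟨by simp [hzero, hi], by simp [hzero, hj]⟩
    · have hs : Q.Same i j := ⟨C, by simp [hparts, hCB, hC], hi, hj⟩
      exact Or.inr ⟨hs, by rw [hlabel i hs.left, hlabel j hs.symm.left]⟩
  | nonzero B C hB hC hne g hzero hparts hlabel =>
    refine ⟨hzero.symm.subset, ?_⟩
    rintro i j ⟨D, hD, hi, hj⟩
    have hs : Q.Same i j := by
      by_cases hDB : D = B
      · subst hDB
        exact ⟨D ∪ C, by simp [hparts], by simp [hi], by simp [hj]⟩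
      by_cases hDC : D = C
      · subst hDC
        exact ⟨B ∪ D, by simp [hparts], by simp [hi], by simp [hj]⟩
      exact ⟨D, by simp [hparts, hDB, hDC, hD], hi, hj⟩
    have hiff : i ∈ C ↔ j ∈ C := by
      constructor
      · intro h
        rwa [← P.part.eq_of_mem_parts hD hC hi h]
      · intro h
        rwa [← P.part.eq_of_mem_parts hD hC hj h]
    refine Or.inr ⟨hs, ?_⟩
    rw [hlabel i hs.left, hlabel j hs.symm.left]
    by_cases hjC : j ∈ C
    · rw [if_pos hjC, if_pos (hiff.2 hjC)]
      simp [mul_assoc]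
    · rw [if_neg hjC, if_neg (fun h => hjC (hiff.1 h))]

/-- The result of merging a nonzero block into the zero block. -/
def mergeZero (P : GPrepartition n G) (B : Finset (Fin n)) (hB : B ∈ P.part.parts) :
    GPrepartition n G where
  zero := P.zero ∪ B
  part := Finpartition.ofExistsUnique (P.part.parts.erase B)
    (fun C hC i hi => by
      rw [Finset.mem_erase] at hC
      rw [Finset.mem_compl, Finset.mem_union, not_or]
      exact ⟨notMem_zero_of_mem_parts hC.2 hi,
        fun hi' => hC.1 (P.part.eq_of_mem_parts hC.2 hB hi hi')⟩)
    (fun i hi => by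
      rw [Finset.mem_compl, Finset.mem_union, not_or] at hi
      obtain ⟨C, hC, hiC⟩ := P.part.exists_mem (Finset.mem_compl.2 hi.1)
      refine ⟨C, ⟨Finset.mem_erase.2 ⟨?_, hC⟩, hiC⟩, fun D hD =>
        P.part.eq_of_mem_parts (Finset.mem_of_mem_erase hD.1) hC hD.2 hiC⟩
      rintro rfl
      exact hi.2 hiC)
    (fun h => P.part.empty_notMem_parts (Finset.mem_of_mem_erase h))
  label := P.label

theorem merge_mergeZero (P : GPrepartition n G) (B : Finset (Fin n)) (hB : B ∈ P.part.parts) :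
    Merge P (P.mergeZero B hB) :=
  .zero B hB rfl rfl fun _ _ => rfl

/-- The result of merging two nonzero blocks `B`, `C` into `B ∪ C · g`. -/
def mergeNonzero (P : GPrepartition n G) (B C : Finset (Fin n)) (hB : B ∈ P.part.parts)
    (hC : C ∈ P.part.parts) (g : G) : GPrepartition n G where
  zero := P.zero
  part := Finpartition.ofExistsUnique (insert (B ∪ C) ((P.part.parts.erase B).erase C))
    (fun D hD i hi => by
      rw [Finset.mem_insert] at hD
      rcases hD with rfl | hD
      · rcases Finset.mem_union.1 hi with hi | hi
        · exact P.part.subset hB hi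
        · exact P.part.subset hC hi
      · exact P.part.subset (Finset.mem_of_mem_erase (Finset.mem_of_mem_erase hD)) hi)
    (fun i hi => by
      obtain ⟨D, hD, hiD⟩ := P.part.exists_mem hi
      by_cases h : i ∈ B ∪ C
      · refine ⟨B ∪ C, ⟨Finset.mem_insert_self _ _, h⟩, ?_⟩
        rintro E ⟨hE, hiE⟩
        rw [Finset.mem_insert, Finset.mem_erase, Finset.mem_erase] at hE
        rcases hE with rfl | ⟨hEC, hEB, hE⟩
        · rfl
        · rcases Finset.mem_union.1 h with h | h
          · exact absurd (P.part.eq_of_mem_parts hE hB hiE h) hEB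
          · exact absurd (P.part.eq_of_mem_parts hE hC hiE h) hEC
      · rw [Finset.mem_union, not_or] at h
        refine ⟨D, ⟨?_, hiD⟩, ?_⟩
        · rw [Finset.mem_insert, Finset.mem_erase, Finset.mem_erase]
          refine Or.inr ⟨?_, ?_, hD⟩
          · rintro rfl
            exact h.2 hiD
          · rintro rfl
            exact h.1 hiD
        · rintro E ⟨hE, hiE⟩
          rw [Finset.mem_insert, Finset.mem_erase, Finset.mem_erase] at hE
          rcases hE with rfl | ⟨-, -, hE⟩
          · rw [Finset.mem_union] at hiE
            tauto
          · exact P.part.eq_of_mem_parts hE hD hiE hiD)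
    (fun h => by
      rw [Finset.mem_insert] at h
      rcases h with h | h
      · exact P.part.ne_empty hB (Finset.union_eq_empty.1 h.symm).1
      · exact P.part.empty_notMem_parts (Finset.mem_of_mem_erase (Finset.mem_of_mem_erase h)))
  label := fun a => if a ∈ C then P.label a * g else P.label a

theorem merge_mergeNonzero (P : GPrepartition n G) (B C : Finset (Fin n))
    (hB : B ∈ P.part.parts) (hC : C ∈ P.part.parts) (hne : B ≠ C) (g : G) :
    Merge P (P.mergeNonzero B C hB hC g) :=
  .nonzero B C hB hC hne g rfl rfl fun _ _ => rfl

theorem Refines.mem_zero {P Q : GPrepartition n G} (h : P.Refines Q) {i j : Fin n}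
    (hij : P.Same i j) (hi : i ∈ Q.zero) : j ∈ Q.zero := by
  rcases h.2 i j hij with ⟨-, hj⟩ | ⟨hs, -⟩
  · exact hj
  · exact absurd hi hs.left

theorem Refines.mergeZero {P Q : GPrepartition n G} (h : P.Refines Q) {B : Finset (Fin n)}
    (hB : B ∈ P.part.parts) {i : Fin n} (hi : i ∈ B) (hiQ : i ∈ Q.zero) :
    (P.mergeZero B hB).Refines Q := by
  refine ⟨Finset.union_subset h.1 fun j hj => h.mem_zero ⟨B, hB, hi, hj⟩ hiQ, ?_⟩
  rintro j k ⟨C, hC, hj, hk⟩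
  exact h.2 j k ⟨C, Finset.mem_of_mem_erase hC, hj, hk⟩

/-- Merging two blocks of `P` that share a block of `Q`, with the translation prescribed by the
labels of `Q`, stays below `Q`. -/
theorem Refines.mergeNonzero {P Q : GPrepartition n G} (h : P.Refines Q) {B C : Finset (Fin n)}
    (hB : B ∈ P.part.parts) (hC : C ∈ P.part.parts) (hne : B ≠ C) {b c : Fin n} (hb : b ∈ B)
    (hc : c ∈ C) (hbc : Q.Same b c) :
    (P.mergeNonzero B C hB hC
      ((P.label c)⁻¹ * Q.label c * (Q.label b)⁻¹ * P.label b)).Refines Q := by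
  set g := (P.label c)⁻¹ * Q.label c * (Q.label b)⁻¹ * P.label b with hg
  have hdisj : ∀ {i}, i ∈ B → i ∉ C := fun hi hi' => hne (P.part.eq_of_mem_parts hB hC hi hi')
  have hlab : ∀ i, (P.mergeNonzero B C hB hC g).label i =
    if i ∈ C then P.label i * g else P.label i := fun _ => rfl
  -- outside the zero block of `Q`, a block of `P` stays in one block of `Q`
  have key : ∀ D ∈ P.part.parts, ∀ i ∈ D, ∀ j ∈ D, Q.Same i i →
      Q.Same i j ∧ Q.label i * (Q.label j)⁻¹ = P.label i * (P.label j)⁻¹ := by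
    intro D hD i hi j hj hii
    rcases h.2 i j ⟨D, hD, hi, hj⟩ with h' | h'
    · exact absurd h'.1 hii.left
    · exact h'
  have hBB : ∀ i ∈ B, Q.Same i b ∧ Q.label i = P.label i * (P.label b)⁻¹ * Q.label b := by
    intro i hi
    obtain ⟨h1, -⟩ := key B hB b hb i hi (same_self.2 hbc.left)
    obtain ⟨h3, h4⟩ := key B hB i hi b hb (h1.symm.trans h1)
    exact ⟨h3, by rw [← h4]; simp⟩
  have hCC : ∀ i ∈ C, Q.Same c i ∧ Q.label i = P.label i * (P.label c)⁻¹ * Q.label c := by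
    intro i hi
    obtain ⟨h1, -⟩ := key C hC c hc i hi (same_self.2 hbc.symm.left)
    obtain ⟨h3, h4⟩ := key C hC i hi c hc (h1.symm.trans h1)
    exact ⟨h1, by rw [← h4]; simp⟩
  refine ⟨h.1, ?_⟩
  rintro i j ⟨D, hD, hi, hj⟩
  replace hD : D ∈ insert (B ∪ C) ((P.part.parts.erase B).erase C) := hD
  rw [Finset.mem_insert, Finset.mem_erase, Finset.mem_erase] at hD
  rcases hD with rfl | ⟨hDC, hDB, hD⟩
  · right
    rw [Finset.mem_union] at hi hj
    rw [hlab, hlab]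
    rcases hi with hi | hi <;> rcases hj with hj | hj
    · rw [if_neg (hdisj hi), if_neg (hdisj hj), (hBB i hi).2, (hBB j hj).2]
      exact ⟨(hBB i hi).1.trans (hBB j hj).1.symm, by group⟩
    · rw [if_neg (hdisj hi), if_pos hj, (hBB i hi).2, (hCC j hj).2, hg]
      exact ⟨((hBB i hi).1.trans hbc).trans (hCC j hj).1, by group⟩
    · rw [if_pos hi, if_neg (hdisj hj), (hCC i hi).2, (hBB j hj).2, hg]
      exact ⟨(((hBB j hj).1.trans hbc).trans (hCC i hi).1).symm, by group⟩
    · rw [if_pos hi, if_pos hj, (hCC i hi).2, (hCC j hj).2]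
      exact ⟨(hCC i hi).1.symm.trans (hCC j hj).1, by group⟩
  · have h1 : i ∉ C := fun h => hDC (P.part.eq_of_mem_parts hD hC hi h)
    have h2 : j ∉ C := fun h => hDC (P.part.eq_of_mem_parts hD hC hj h)
    rw [hlab, hlab, if_neg h1, if_neg h2]
    exact h.2 i j ⟨D, hD, hi, hj⟩

end GPrepartition

namespace Dowling

open GPrepartition

variable {n : ℕ} {G : Type*} [Group G]

theorem covers_of_merge {P Q : GPrepartition n G} (h : Merge P Q) : Covers (mk P) (mk Q) :=
  ⟨P, Q, rfl, rfl, h⟩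

theorem refines_of_mk_eq {P Q : GPrepartition n G} (h : mk P = mk Q) : P.Refines Q :=
  refines_of_equiv (Quotient.exact h)

theorem exists_mk_eq (x : Dowling n G) : ∃ P, mk P = x :=
  Quotient.exists_rep x

/-- The order generated by merging blocks implies the elementwise description. -/
theorem refines_of_mk_le {P Q : GPrepartition n G} (h : mk P ≤ mk Q) : P.Refines Q := by
  have aux : ∀ y, Relation.ReflTransGen Covers (mk P) y → ∀ Q, mk Q = y → P.Refines Q := by
    intro y hy
    induction hy with
    | refl => exact fun Q hQ => refines_of_mk_eq hQ.symm
    | tail _ hc ih =>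
      intro Q hQ
      obtain ⟨R, S, hR, hS, hRS⟩ := hc
      exact ((ih R hR).trans hRS.refines).trans (refines_of_mk_eq (hS.trans hQ.symm))
  exact aux _ h Q rfl

/-- As long as `P` and `Q` are not equivalent, two blocks of `P` can be merged below `Q`, which
lowers the number of nonzero blocks of `P`. -/
theorem mk_le_of_refines {P Q : GPrepartition n G} (h : P.Refines Q) : mk P ≤ mk Q := by
  by_cases ha : ∃ B ∈ P.part.parts, ∃ i ∈ B, i ∈ Q.zero
  · obtain ⟨B, hB, i, hi, hiQ⟩ := ha
    have := (P.merge_mergeZero B hB).card_lt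
    exact Relation.ReflTransGen.head (covers_of_merge (P.merge_mergeZero B hB))
      (mk_le_of_refines (h.mergeZero hB hi hiQ))
  by_cases hb : ∃ B ∈ P.part.parts, ∃ C ∈ P.part.parts, B ≠ C ∧ ∃ b ∈ B, ∃ c ∈ C, Q.Same b c
  · obtain ⟨B, hB, C, hC, hne, b, hb, c, hc, hbc⟩ := hb
    have hm := P.merge_mergeNonzero B C hB hC hne
      ((P.label c)⁻¹ * Q.label c * (Q.label b)⁻¹ * P.label b)
    have := hm.card_lt
    exact Relation.ReflTransGen.head (covers_of_merge hm)
      (mk_le_of_refines (h.mergeNonzero hB hC hne hb hc hbc))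
  -- no merge is possible below `Q`: the two prepartitions are equivalent
  have hz : P.zero = Q.zero := by
    refine h.1.antisymm fun i hi => ?_
    by_contra hiP
    obtain ⟨B, hB, hiB⟩ := P.part.exists_mem (Finset.mem_compl.2 hiP)
    exact ha ⟨B, hB, i, hiB, hi⟩
  have hPQ : ∀ i j, P.Same i j →
      Q.Same i j ∧ Q.label i * (Q.label j)⁻¹ = P.label i * (P.label j)⁻¹ := by
    intro i j hij
    rcases h.2 i j hij with h' | h'
    · exact absurd (hz ▸ h'.1) hij.left
    · exact h'
  refine le_of_eq (Quotient.sound (equiv_of_same_iff hz (fun i j => ⟨fun hij => (hPQ i j hij).1,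
    fun hij => ?_⟩) fun i j hij => (hPQ i j hij).2))
  obtain ⟨B, hB, hi⟩ := P.part.exists_mem (Finset.mem_compl.2 (hz ▸ hij.left))
  obtain ⟨C, hC, hj⟩ := P.part.exists_mem (Finset.mem_compl.2 (hz ▸ hij.symm.left))
  by_cases hBC : B = C
  · exact ⟨B, hB, hi, hBC ▸ hj⟩
  · exact absurd ⟨B, hB, C, hC, hBC, i, hi, j, hj, hij⟩ hb
termination_by P.part.parts.card

theorem mk_le_mk {P Q : GPrepartition n G} : mk P ≤ mk Q ↔ P.Refines Q :=
  ⟨refines_of_mk_le, mk_le_of_refines⟩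

end Dowling

/-! ### The subspace of a `G`-partition -/

namespace GPrepartition

variable {n : ℕ} {G : Type*}

/-- The subspace of `ℂⁿ` attached to a prepartition by a character `χ` of the group of labels: the
vectors that vanish on the zero block and are proportional to `χ ∘ label` on each nonzero block. -/
def subspace [Group G] (χ : G →* ℂˣ) (P : GPrepartition n G) : Submodule ℂ (Fin n → ℂ) where
  carrier := {v | (∀ i ∈ P.zero, v i = 0) ∧
    ∀ i j, P.Same i j → v i * χ (P.label j) = v j * χ (P.label i)}
  zero_mem' := ⟨fun _ _ => rfl, fun _ _ _ => by simp⟩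
  add_mem' := by
    rintro v w ⟨h1, h2⟩ ⟨h1', h2'⟩
    refine ⟨fun i hi => by simp [h1 i hi, h1' i hi], fun i j hij => ?_⟩
    rw [Pi.add_apply, Pi.add_apply, add_mul, add_mul, h2 i j hij, h2' i j hij]
  smul_mem' := by
    rintro c v ⟨h1, h2⟩
    refine ⟨fun i hi => by simp [h1 i hi], fun i j hij => ?_⟩
    rw [Pi.smul_apply, Pi.smul_apply, smul_eq_mul, smul_eq_mul, mul_assoc, h2 i j hij, mul_assoc]

variable [Group G] {χ : G →* ℂˣ}

theorem mem_subspace {P : GPrepartition n G} {v : Fin n → ℂ} :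
    v ∈ P.subspace χ ↔ (∀ i ∈ P.zero, v i = 0) ∧
      ∀ i j, P.Same i j → v i * χ (P.label j) = v j * χ (P.label i) :=
  Iff.rfl

/-- For each `k` outside the zero block, the subspace contains a vector supported on exactly the
block of `k`. -/
theorem blockVector_mem_subspace (P : GPrepartition n G) (k : Fin n) [DecidablePred (P.Same k)] :
    (fun i => if P.Same k i then (χ (P.label i) : ℂ) else 0) ∈ P.subspace χ := by
  refine ⟨fun i hi => if_neg fun h => h.symm.left hi, fun i j hij => ?_⟩
  dsimp only
  by_cases h : P.Same k i
  · rw [if_pos h, if_pos (h.trans hij), mul_comm]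
  · rw [if_neg h, if_neg fun h' => h (h'.trans hij.symm), zero_mul, zero_mul]

theorem subspace_le_of_refines {P Q : GPrepartition n G} (h : P.Refines Q) :
    Q.subspace χ ≤ P.subspace χ := by
  rintro v ⟨h1, h2⟩
  refine ⟨fun i hi => h1 i (h.1 hi), fun i j hij => ?_⟩
  rcases h.2 i j hij with ⟨hi, hj⟩ | ⟨hs, e⟩
  · rw [h1 i hi, h1 j hj, zero_mul, zero_mul]
  · have e' : (χ (Q.label i) : ℂ) * χ (P.label j) = χ (P.label i) * χ (Q.label j) := by
      have := congrArg χ e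
      rw [map_mul, map_mul, map_inv, map_inv, ← div_eq_mul_inv, ← div_eq_mul_inv,
        div_eq_div_iff_mul_eq_mul] at this
      exact_mod_cast congrArg Units.val this
    apply mul_right_cancel₀ (χ (Q.label j)).ne_zero
    linear_combination (χ (P.label j) : ℂ) * h2 i j hs + v j * e'

/-- The vectors supported on single blocks detect the order. -/
theorem refines_of_subspace_le (hχ : Function.Injective χ) {P Q : GPrepartition n G}
    (h : Q.subspace χ ≤ P.subspace χ) : P.Refines Q := by
  classical
  have hv := fun k => h (Q.blockVector_mem_subspace (χ := χ) k)
  refine ⟨fun i hi => ?_, fun i j hij => ?_⟩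
  · by_contra hiQ
    have := (hv i).1 i hi
    simp [same_self.2 hiQ] at this
  · by_cases hi : i ∈ Q.zero
    · refine Or.inl ⟨hi, ?_⟩
      by_contra hj
      have := (hv j).2 i j hij
      have hji : ¬ Q.Same j i := fun h => h.symm.left hi
      simp [same_self.2 hj, hji] at this
    · right
      have := (hv i).2 i j hij
      dsimp only at this
      rw [if_pos (same_self.2 hi)] at this
      by_cases hs : Q.Same i j
      · rw [if_pos hs] at this
        have e : χ (Q.label i) * χ (P.label j) = χ (Q.label j) * χ (P.label i) := by
          exact_mod_cast this
        refine ⟨hs, hχ ?_⟩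
        rw [map_mul, map_mul, map_inv, map_inv, ← div_eq_mul_inv, ← div_eq_mul_inv,
          div_eq_div_iff_mul_eq_mul, e, mul_comm]
      · simp [hs] at this

end GPrepartition

namespace Dowling

open GPrepartition

variable {n : ℕ} {G : Type*} [Group G]

/-- The embedding of the Dowling lattice into the subspaces of `ℂⁿ`, ordered by reverse
inclusion, given by an injective character of the group of labels. -/
noncomputable def subspaceEmbedding (χ : G →* ℂˣ) (hχ : Function.Injective χ) :
    Dowling n G ↪o (Submodule ℂ (Fin n → ℂ))ᵒᵈ :=
  OrderEmbedding.ofMapLEIff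
    (fun x => OrderDual.toDual ((Quotient.out (s := GPrepartition.setoid n G) x).subspace χ))
    (fun x y => by
      rw [OrderDual.toDual_le_toDual]
      conv_rhs => rw [← Quotient.out_eq (s := GPrepartition.setoid n G) x,
        ← Quotient.out_eq (s := GPrepartition.setoid n G) y]
      exact ⟨fun h => mk_le_of_refines (refines_of_subspace_le hχ h),
        fun h => subspace_le_of_refines (refines_of_mk_le h)⟩)

theorem subspaceEmbedding_mk (χ : G →* ℂˣ) (hχ : Function.Injective χ) (P : GPrepartition n G) :
    subspaceEmbedding χ hχ (mk P) = OrderDual.toDual (P.subspace χ) := by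
  have h : mk (Quotient.out (s := GPrepartition.setoid n G) (mk P)) = mk P :=
    Quotient.out_eq (s := GPrepartition.setoid n G) (mk P)
  exact congrArg OrderDual.toDual ((subspace_le_of_refines (refines_of_mk_eq h.symm)).antisymm
    (subspace_le_of_refines (refines_of_mk_eq h)))

end Dowling

/-- An order embedding that maps one set onto another restricts to an isomorphism. -/
theorem nonempty_orderIso_of_image_eq {α β : Type*} [PartialOrder α] [PartialOrder β] (f : α ↪o β)
    {s : Set α} {t : Set β} (h : f '' s = t) : Nonempty (t ≃o s) := by
  subst h
  exact ⟨OrderIso.symm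
    { toEquiv := Equiv.Set.image f s f.injective
      map_rel_iff' := f.map_rel_iff }⟩

/-! ### Monomial maps without eigenvectors -/

/-- There is a monomial map `e_j ↦ θ_{τ(j)} e_{τ(j)}` of `ℂ^α` without eigenvector for the
eigenvalue `z`, whose coefficients are `r`-th roots of unity with product `t`. -/
def ExistsMonomialWithoutEigenvector (r : ℕ) (z : ℂˣ) (α : Type*) [Fintype α] (t : ℂˣ) : Prop :=
  ∃ (τ : Equiv.Perm α) (θ : α → ℂˣ), (∀ i, θ i ^ r = 1) ∧ ∏ i, θ i = t ∧
    ∀ v : α → ℂ, (∀ j, (θ (τ j) : ℂ) * v j = z * v (τ j)) → v = 0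

namespace ExistsMonomialWithoutEigenvector

variable {r : ℕ} {z t : ℂˣ} {α β : Type*} [Fintype α] [Fintype β]

theorem congr (e : α ≃ β) (h : ExistsMonomialWithoutEigenvector r z α t) :
    ExistsMonomialWithoutEigenvector r z β t := by
  obtain ⟨τ, θ, h1, h2, h3⟩ := h
  refine ⟨e.permCongr τ, fun i => θ (e.symm i), fun i => h1 _, ?_, fun v hv => ?_⟩
  · rw [Equiv.prod_comp e.symm θ, h2]
  · have := h3 (fun i => v (e i)) fun j => by simpa using hv (e j)
    funext i
    simpa using congrFun this (e.symm i)

/-- A fixed point whose coefficient is not `z` can be added. -/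
theorem option {s : ℂˣ} (h : ExistsMonomialWithoutEigenvector r z α t) (hs : s ^ r = 1)
    (hsz : s ≠ z) : ExistsMonomialWithoutEigenvector r z (Option α) (s * t) := by
  obtain ⟨τ, θ, h1, h2, h3⟩ := h
  refine ⟨Equiv.optionCongr τ, fun i => i.elim s θ, ?_, ?_, fun v hv => ?_⟩
  · rintro (_ | i)
    · exact hs
    · exact h1 i
  · simp [Fintype.prod_option, h2]
  · have h := h3 (fun i => v (some i)) fun j => by simpa using hv (some j)
    funext i
    cases i with
    | none =>
      have h0 : (s : ℂ) * v none = z * v none := by simpa using hv none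
      by_contra hne
      exact hsz (Units.ext (mul_right_cancel₀ hne h0))
    | some i => exact congrFun h i

/-- Fixed points suffice if `z` is not an `r`-th root of unity. -/
theorem of_pow_ne_one [Nonempty α] (hz : z ^ r ≠ 1) (ht : t ^ r = 1) :
    ExistsMonomialWithoutEigenvector r z α t := by
  classical
  obtain ⟨a⟩ := ‹Nonempty α›
  have hθ : ∀ i, (Function.update (fun _ => 1) a t : α → ℂˣ) i ^ r = 1 := by
    intro i
    by_cases h : i = a
    · subst h
      simpa using ht
    · simp [h]
  refine ⟨1, Function.update (fun _ => 1) a t, hθ, ?_, fun v hv => ?_⟩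
  · rw [Finset.prod_update_of_mem (Finset.mem_univ a)]
    simp
  · funext i
    by_contra hne
    have h := Units.ext (mul_right_cancel₀ hne (hv i))
    exact hz (h ▸ hθ i)

end ExistsMonomialWithoutEigenvector

/-- An eigenvector without zeros on an invariant set determines the product of the coefficients
over this set. -/
theorem prod_eq_pow_card_of_eigenvector {α : Type*} {τ : Equiv.Perm α} {θ : α → ℂˣ} {z : ℂˣ}
    {v : α → ℂ} {s : Finset α} (hv : ∀ j ∈ s, (θ (τ j) : ℂ) * v j = z * v (τ j))
    (hs : ∀ j, τ j ∈ s ↔ j ∈ s) (hne : ∀ j ∈ s, v j ≠ 0) : ∏ i ∈ s, θ i = z ^ s.card := by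
  have hperm : ∀ f : α → ℂ, ∏ j ∈ s, f (τ j) = ∏ j ∈ s, f j := fun f =>
    Finset.prod_bij (fun j _ => τ j) (fun j hj => (hs j).2 hj) (fun _ _ _ _ h => τ.injective h)
      (fun j hj => ⟨τ.symm j, (hs _).1 (by simpa using hj), by simp⟩) fun _ _ => rfl
  have h := Finset.prod_congr (rfl : s = s) hv
  rw [Finset.prod_mul_distrib, Finset.prod_mul_distrib, Finset.prod_const, hperm v,
    hperm fun i => (θ i : ℂ)] at h
  apply Units.ext
  push_cast
  exact mul_right_cancel₀ (Finset.prod_ne_zero_iff.2 hne) h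

/-- Functions all of whose fibres have the same size are conjugate by a bijection. -/
theorem exists_equiv_of_card_fibre_eq {α β γ : Type*} [Fintype α] [Fintype β] [Fintype γ]
    [DecidableEq γ] [Nonempty γ] (f : α → γ) (g : β → γ)
    (hf : ∀ i j, (Finset.univ.filter fun a => f a = i).card =
      (Finset.univ.filter fun a => f a = j).card)
    (hg : ∀ i j, (Finset.univ.filter fun a => g a = i).card =
      (Finset.univ.filter fun a => g a = j).card)
    (h : Fintype.card α = Fintype.card β) : ∃ e : α ≃ β, ∀ a, g (e a) = f a := by
  obtain ⟨k⟩ := ‹Nonempty γ›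
  have hf' : Fintype.card α = Fintype.card γ * (Finset.univ.filter fun a => f a = k).card := by
    rw [← Finset.card_univ,
      Finset.card_eq_sum_card_fiberwise (f := f) (t := Finset.univ) (by simp),
      Finset.sum_congr rfl fun i _ => hf i k]
    simp
  have hg' : Fintype.card β = Fintype.card γ * (Finset.univ.filter fun a => g a = k).card := by
    rw [← Finset.card_univ,
      Finset.card_eq_sum_card_fiberwise (f := g) (t := Finset.univ) (by simp),
      Finset.sum_congr rfl fun i _ => hg i k]
    simp
  have hk : (Finset.univ.filter fun a => f a = k).card =
      (Finset.univ.filter fun a => g a = k).card :=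
    Nat.eq_of_mul_eq_mul_left (Fintype.card_pos_iff.2 ⟨k⟩) (hf'.symm.trans (h.trans hg'))
  have hc : ∀ i, Nonempty ({a // f a = i} ≃ {b // g b = i}) := fun i => by
    rw [← Fintype.card_eq, Fintype.card_subtype, Fintype.card_subtype, hf i k, hk, hg k i]
  have e := fun i => (hc i).some
  refine ⟨(Equiv.sigmaFiberEquiv f).symm.trans
    ((Equiv.sigmaCongrRight e).trans (Equiv.sigmaFiberEquiv g)), fun a => ?_⟩
  exact (e (f a) ⟨a, rfl⟩).2

/-- A finite set that is evenly coloured by `ℤ/d` has a transitive permutation along which the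
colour changes by a given unit. -/
theorem exists_transitive_perm {α : Type*} [Fintype α] {d : ℕ} [NeZero d] (c : α → ZMod d)
    (hc : ∀ i j, (Finset.univ.filter fun a => c a = i).card =
      (Finset.univ.filter fun a => c a = j).card) {u : ZMod d} (hu : IsUnit u) :
    ∃ τ : Equiv.Perm α, (∀ a b, ∃ k : ℕ, (τ ^ k) a = b) ∧ ∀ a, c (τ a) = c a + u := by
  rcases isEmpty_or_nonempty α with hα | hα
  · exact ⟨1, fun a => hα.elim a, fun a => hα.elim a⟩
  have hdvd : d ∣ Fintype.card α := by
    rw [← Finset.card_univ,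
      Finset.card_eq_sum_card_fiberwise (f := c) (t := Finset.univ) (by simp),
      Finset.sum_congr rfl fun i _ => hc i 0]
    simp
  have : NeZero (Fintype.card α) := ⟨Fintype.card_ne_zero⟩
  -- `α` is identified with `ℤ/|α|` so that the colour becomes `u` times the reduction modulo `d`;
  -- the permutation is then `x ↦ x + 1`
  let g : ZMod (Fintype.card α) → ZMod d := fun x => u * ZMod.castHom hdvd (ZMod d) x
  have hgs : ∀ i, ∃ x, g x = i := fun i => by
    obtain ⟨x, hx⟩ := ZMod.castHom_surjective hdvd (hu.unit⁻¹ * i)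
    exact ⟨x, by simp only [g]; rw [hx, ← mul_assoc, IsUnit.mul_val_inv, one_mul]⟩
  have hga : ∀ x y, g (x + y) = g x + g y := fun x y => by simp only [g, map_add, mul_add]
  have hg : ∀ i j, (Finset.univ.filter fun a => g a = i).card =
      (Finset.univ.filter fun a => g a = j).card := by
    intro i j
    obtain ⟨x, hx⟩ := hgs (j - i)
    refine Finset.card_equiv (Equiv.addRight x) fun a => ?_
    simp only [Finset.mem_filter, Finset.mem_univ, true_and, Equiv.coe_addRight, hga, hx]
    constructor
    · rintro rfl
      ring
    · intro h
      linear_combination h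
  obtain ⟨e, he⟩ := exists_equiv_of_card_fibre_eq c g hc hg (ZMod.card _).symm
  have hpow : ∀ (k : ℕ) (a : α), ((e.symm.permCongr (Equiv.addRight 1)) ^ k) a =
      e.symm (e a + k) := by
    intro k
    induction k with
    | zero => intro a; simp
    | succ k ih =>
      intro a
      rw [pow_succ', Equiv.Perm.mul_apply, ih]
      simp [Equiv.permCongr_apply, add_assoc]
  refine ⟨e.symm.permCongr (Equiv.addRight 1), fun a b => ⟨(e b - e a).val, ?_⟩, fun a => ?_⟩
  · rw [hpow]
    simp
  · rw [← he, ← he, Equiv.permCongr_apply]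
    simp only [Equiv.symm_symm, Equiv.apply_symm_apply, Equiv.coe_addRight, hga]
    simp only [g, map_one, mul_one]

namespace ExistsMonomialWithoutEigenvector

variable {r : ℕ} {z t : ℂˣ} {α : Type*} [Fintype α]

/-- A monomial map with a single cycle has the eigenvalue `z` only if the product of the
coefficients is the right power of `z`. -/
theorem of_ne_pow_card [Nonempty α] (hz : z ^ r = 1) (ht : t ^ r = 1)
    (htz : t ≠ z ^ Fintype.card α) : ExistsMonomialWithoutEigenvector r z α t := by
  classical
  have ⟨a⟩ := ‹Nonempty α›
  obtain ⟨τ, hτ, -⟩ := exists_transitive_perm (d := 1) (fun _ : α => 0)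
    (fun i j => by rw [Subsingleton.elim i j]) (isUnit_of_subsingleton 0)
  let θ : α → ℂˣ := Function.update (fun _ => z) a (t * z / z ^ Fintype.card α)
  have hθ : ∏ i, θ i = t := by
    have hα : 0 < Fintype.card α := Fintype.card_pos
    rw [Finset.prod_update_of_mem (Finset.mem_univ a), Finset.prod_const,
      Finset.card_sdiff_of_subset (Finset.subset_univ _), Finset.card_univ, Finset.card_singleton,
      div_mul_eq_mul_div, mul_assoc, ← pow_succ', Nat.sub_add_cancel hα, mul_div_cancel_right]
  refine ⟨τ, θ, fun i => ?_, hθ, fun v hv => ?_⟩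
  · by_cases h : i = a
    · subst h
      simp only [θ, Function.update_self]
      rw [div_pow, mul_pow, ht, hz, pow_right_comm, hz]
      simp
    · simp [θ, h, hz]
  · by_contra hne
    obtain ⟨b, hb⟩ := Function.ne_iff.1 hne
    have hstep : ∀ j, v j ≠ 0 → v (τ j) ≠ 0 := fun j hj h => by
      have := hv j
      rw [h, mul_zero] at this
      exact (mul_ne_zero (Units.ne_zero _) hj) this
    have hall : ∀ (k : ℕ), v ((τ ^ k) b) ≠ 0 := by
      intro k
      induction k with
      | zero => exact hb
      | succ k ih => rw [pow_succ', Equiv.Perm.mul_apply]; exact hstep _ ih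
    have := prod_eq_pow_card_of_eigenvector (s := Finset.univ) (fun j _ => hv j) (by simp)
      fun j _ => by
        obtain ⟨k, rfl⟩ := hτ b j
        exact hall k
    exact htz (hθ.symm.trans this)

/-- The product `z ^ |α|`, which a single cycle excludes, is attained by a fixed point with
coefficient `w z` and a cycle on the remaining coordinates with product `w⁻¹ z ^ (|α| - 1)`. -/
theorem of_eq_pow_card (hz : z ^ r = 1) {w : ℂˣ} (hw : w ^ r = 1) (hw1 : w ≠ 1)
    (hα : 2 ≤ Fintype.card α) :
    ExistsMonomialWithoutEigenvector r z α (z ^ Fintype.card α) := by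
  obtain ⟨k, hk⟩ : ∃ k, Fintype.card α = k + 1 + 1 := ⟨Fintype.card α - 2, by omega⟩
  have h := (of_ne_pow_card (α := Fin (k + 1)) (t := w⁻¹ * z ^ (k + 1)) hz
    (by rw [mul_pow, inv_pow, hw, pow_right_comm, hz]; simp) (by simpa using hw1)).option
    (s := w * z) (by rw [mul_pow, hw, hz, one_mul]) (by simpa using hw1)
  have e : w * z * (w⁻¹ * z ^ (k + 1)) = z ^ Fintype.card α := by
    rw [hk, pow_succ' z (k + 1), mul_mul_mul_comm, mul_inv_cancel, one_mul]
  rw [e] at h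
  exact h.congr (Fintype.equivOfCardEq (by simp [hk]))

theorem of_isEmpty [IsEmpty α] : ExistsMonomialWithoutEigenvector r z α 1 :=
  ⟨1, fun _ => 1, fun _ => one_pow r, by simp, fun _ _ => Subsingleton.elim _ _⟩

theorem eq_one_of_isEmpty [IsEmpty α] (h : ExistsMonomialWithoutEigenvector r z α t) : t = 1 := by
  obtain ⟨τ, θ, -, h, -⟩ := h
  rw [← h, Finset.prod_of_isEmpty]

theorem ne_of_unique [Unique α] (h : ExistsMonomialWithoutEigenvector r z α t) : t ≠ z := by
  rintro rfl
  obtain ⟨τ, θ, -, h, hv⟩ := h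
  rw [Fintype.prod_unique] at h
  have := hv (fun _ => 1) fun j => by rw [Subsingleton.elim (τ j) default, h]
  exact one_ne_zero (congrFun this default)

theorem isEmpty_of_one (h : ExistsMonomialWithoutEigenvector 1 1 α t) : IsEmpty α := by
  obtain ⟨τ, θ, h1, -, hv⟩ := h
  refine ⟨fun a => one_ne_zero (congrFun (hv (fun _ => 1) fun j => ?_) a)⟩
  rw [(pow_one _).symm.trans (h1 (τ j))]

end ExistsMonomialWithoutEigenvector

/-! ### Eigenspaces of monomial matrices -/

theorem mem_eigenspace_monomialMatrix {n : ℕ} {θ : Fin n → ℂˣ} {σ : Equiv.Perm (Fin n)} {z : ℂ}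
    {v : Fin n → ℂ} :
    v ∈ Module.End.eigenspace (Matrix.toLin' (monomialMatrix θ σ)) z ↔
      ∀ j, (θ (σ j) : ℂ) * v j = z * v (σ j) := by
  rw [Module.End.mem_eigenspace_iff, Matrix.toLin'_apply, funext_iff, ← σ.forall_congr_right]
  refine forall_congr' fun j => ?_
  rw [Matrix.mulVec, dotProduct, Finset.sum_eq_single j]
  · simp [monomialMatrix]
  · intro k _ hk
    simp [monomialMatrix, hk.symm]
  · simp

/-- The coset `diag(ξ, 1, …, 1) G(r, p, n)` consists of the monomial matrices whose nonzero
entries are `r`-th roots of unity with product in the coset `ξ μ_{r/p}`. -/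
theorem mem_matrixCoset_iff {r p n : ℕ} (hn : 0 < n) {x : ℂˣ} (hx : x ^ r = 1)
    {M : Matrix (Fin n) (Fin n) ℂ} :
    M ∈ matrixCoset (diagFirst n (x : ℂ)) (imprimitiveGroup r p n) ↔
      ∃ (θ : Fin n → ℂˣ) (σ : Equiv.Perm (Fin n)), (∀ i, θ i ^ r = 1) ∧
        ((∏ i, θ i) * x⁻¹) ^ (r / p) = 1 ∧ M = monomialMatrix θ σ := by
  have hmul : ∀ (θ : Fin n → ℂˣ) (σ : Equiv.Perm (Fin n)),
      diagFirst n (x : ℂ) * monomialMatrix θ σ =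
        monomialMatrix (fun i => (if (i : ℕ) = 0 then x else 1) * θ i) σ := by
    intro θ σ
    ext i j
    simp only [diagFirst, Matrix.diagonal_mul, monomialMatrix, Matrix.of_apply]
    split_ifs <;> simp
  have hprod : ∀ y : ℂˣ, ∏ i : Fin n, (if (i : ℕ) = 0 then y else 1) = y := by
    intro y
    rw [Finset.prod_eq_single ⟨0, hn⟩]
    · simp
    · intro b _ hb
      exact if_neg fun h => hb (Fin.ext h)
    · simp
  constructor
  · rintro ⟨g, ⟨θ, σ, h1, h2, h3⟩, rfl⟩
    refine ⟨_, σ, fun i => ?_, ?_, by rw [h3, hmul]⟩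
    · rw [mul_pow, h1, mul_one]
      split_ifs
      · exact hx
      · exact one_pow r
    · rw [Finset.prod_mul_distrib, hprod, mul_right_comm, mul_inv_cancel, one_mul, h2]
  · rintro ⟨θ, σ, h1, h2, rfl⟩
    let θ' : Fin n → ℂˣ := fun i => (if (i : ℕ) = 0 then x⁻¹ else 1) * θ i
    have hinv : ∀ (θ : Fin n → ℂˣ) (σ : Equiv.Perm (Fin n)),
        monomialMatrix θ σ * monomialMatrix (fun i => (θ (σ i))⁻¹) σ⁻¹ = 1 := by
      intro θ σ
      rw [monomialMatrix_mul, ← monomialMatrix_one]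
      congr 1
      · ext i
        simp
      · simp
    refine ⟨⟨monomialMatrix θ' σ, monomialMatrix (fun i => (θ' (σ i))⁻¹) σ⁻¹, hinv _ _,
      mul_eq_one_comm.1 (hinv _ _)⟩, ⟨θ', σ, fun i => ?_, ?_, rfl⟩, ?_⟩
    · simp only [θ']
      rw [mul_pow, h1, mul_one]
      split_ifs
      · rw [inv_pow, hx, inv_one]
      · exact one_pow r
    · rw [Finset.prod_mul_distrib, hprod, mul_comm, h2]
    · rw [hmul]
      congr 1
      funext i
      simp only [θ', ← mul_assoc]
      split_ifs <;> simp

/-! ### Roots of unity as labels -/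

/-- If `z` has order `m` and `d = m / gcd(m, r)`, the roots of unity of order dividing `d r` can
be labelled by `ℤ/dr` in such a way that the `r`-th roots of unity are the elements with label
`0` modulo `d`, and the label of `z` generates `ℤ/d`. -/
theorem exists_rootsOfUnity_labelling {r m d N : ℕ} (hr : 0 < r) (hm : 0 < m)
    (hd : d = m / Nat.gcd m r) (hN : N = d * r) {z : ℂˣ} (hz : IsPrimitiveRoot z m) :
    ∃ (χ : Multiplicative (ZMod N) →* ℂˣ) (z₀ : Multiplicative (ZMod N)), Function.Injective χ ∧
      (∀ u : ℂˣ, u ^ r = 1 → ∃ g, χ g = u) ∧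
      (∀ g, χ g ^ r = 1 ↔ (ZMod.cast g.toAdd : ZMod d) = 0) ∧ χ z₀ = z ∧
      IsUnit (ZMod.cast z₀.toAdd : ZMod d) := by
  have hg : 0 < Nat.gcd m r := Nat.gcd_pos_of_pos_left r hm
  have hmd : m = d * Nat.gcd m r := by rw [hd, Nat.div_mul_cancel (Nat.gcd_dvd_left m r)]
  have hd0 : 0 < d := by
    rw [hd]
    exact Nat.div_pos (Nat.le_of_dvd hm (Nat.gcd_dvd_left m r)) hg
  have hN0 : 0 < N := hN ▸ Nat.mul_pos hd0 hr
  have : NeZero N := ⟨hN0.ne'⟩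
  have : NeZero d := ⟨hd0.ne'⟩
  have hdN : d ∣ N := hN ▸ Dvd.intro r rfl
  let χ : Multiplicative (ZMod N) →* ℂˣ := (ZMod.stdAddChar (N := N)).toMonoidHom.toHomUnits
  have hχ : Function.Injective χ := by
    intro a b hab
    exact ZMod.injective_stdAddChar (congrArg Units.val hab)
  have hχN : ∀ g, χ g ^ N = 1 := by
    intro g
    rw [← map_pow, show g ^ N = 1 from by
      apply Multiplicative.toAdd.injective
      rw [toAdd_pow, nsmul_eq_mul, ZMod.natCast_self, zero_mul, toAdd_one], map_one]
  have hsurj : ∀ u : ℂˣ, u ^ N = 1 → ∃ g, χ g = u := by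
    intro u hu
    have hprim : IsPrimitiveRoot (χ (Multiplicative.ofAdd 1)) N := by
      rw [IsPrimitiveRoot.iff_def]
      refine ⟨hχN _, fun l hl => ?_⟩
      rw [← map_pow, ← map_one χ] at hl
      have := congrArg Multiplicative.toAdd (hχ hl)
      rw [toAdd_pow, toAdd_ofAdd, toAdd_one, nsmul_eq_mul, mul_one] at this
      exact (ZMod.natCast_eq_zero_iff l N).1 this
    obtain ⟨i, -, hi⟩ := (hprim.map_of_injective (f := Units.coeHom ℂ)
      Units.val_injective).eq_pow_of_pow_eq_one (ξ := (u : ℂ)) 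
      (by rw [← Units.val_pow_eq_pow_val, hu, Units.val_one])
    refine ⟨Multiplicative.ofAdd 1 ^ i, Units.ext ?_⟩
    rw [map_pow, Units.val_pow_eq_pow_val]
    exact hi
  have hker : ∀ g, χ g ^ r = 1 ↔ (ZMod.cast g.toAdd : ZMod d) = 0 := by
    intro g
    obtain ⟨k, hk⟩ : ∃ k : ℕ, g.toAdd = k := ⟨g.toAdd.val, (ZMod.natCast_zmod_val _).symm⟩
    rw [← map_pow, ← map_one χ, hχ.eq_iff, ← Multiplicative.toAdd.injective.eq_iff, toAdd_pow,
      toAdd_one, hk, ZMod.cast_natCast hdN, nsmul_eq_mul, ← Nat.cast_mul,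
      ZMod.natCast_eq_zero_iff, ZMod.natCast_eq_zero_iff, hN, mul_comm d,
      Nat.mul_dvd_mul_iff_left hr]
  have hzr : ∀ k : ℕ, (z ^ k) ^ r = 1 → d ∣ k := by
    intro k hk
    rw [← pow_mul] at hk
    have h := (hz.pow_eq_one_iff_dvd _).1 hk
    have hcop : Nat.Coprime d (r / Nat.gcd m r) := hd ▸ Nat.coprime_div_gcd_div_gcd hg
    refine hcop.dvd_of_dvd_mul_right (Nat.dvd_of_mul_dvd_mul_right hg ?_)
    rwa [mul_assoc, Nat.div_mul_cancel (Nat.gcd_dvd_right m r), ← hmd]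
  obtain ⟨z₀, hz₀⟩ := hsurj z (by
    refine (hz.pow_eq_one_iff_dvd N).2 ?_
    rw [hN]
    nth_rewrite 1 [hmd]
    exact Nat.mul_dvd_mul_left d (Nat.gcd_dvd_right m r))
  refine ⟨χ, z₀, hχ, fun u hu => hsurj u ?_, hker, hz₀, ?_⟩
  · rw [hN, mul_comm, pow_mul, hu, one_pow]
  · rw [isUnit_iff_mem_nonZeroDivisors_of_finite, mem_nonZeroDivisors_iff_right]
    intro a ha
    have h : (ZMod.cast (z₀ ^ a.val).toAdd : ZMod d) = 0 := by
      rw [toAdd_pow, nsmul_eq_mul, ← ZMod.castHom_apply (h := hdN), map_mul, map_natCast,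
        ZMod.natCast_zmod_val, ZMod.castHom_apply, ha]
    rw [← hker, map_pow, hz₀] at h
    rw [← ZMod.natCast_zmod_val a, ZMod.natCast_eq_zero_iff]
    exact hzr _ h

/-! ### Permutations with prescribed cycles -/

/-- If each fibre of `f` is evenly coloured by `ℤ/d`, some permutation has the fibres of `f` as
its cycles and changes the colour by a given unit. -/
theorem exists_perm_transitive_on_fibres {α β : Type*} [Fintype α] [DecidableEq β] {d : ℕ}
    [NeZero d] (f : α → β) (c : α → ZMod d)
    (hc : ∀ y i j, (Finset.univ.filter fun a => f a = y ∧ c a = i).card =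
      (Finset.univ.filter fun a => f a = y ∧ c a = j).card) {u : ZMod d} (hu : IsUnit u) :
    ∃ τ : Equiv.Perm α, (∀ a, f (τ a) = f a) ∧
      (∀ a b, f a = f b → ∃ k : ℕ, (τ ^ k) a = b) ∧ ∀ a, c (τ a) = c a + u := by
  have hcard : ∀ y i, (Finset.univ.filter fun a : {a // f a = y} => c a = i).card =
      (Finset.univ.filter fun a => f a = y ∧ c a = i).card := by
    intro y i
    rw [← Finset.filter_filter, ← Finset.card_map (Function.Embedding.subtype _)]
    congr 1
    ext a
    simp [and_comm]
  have h := fun y => exists_transitive_perm (fun a : {a // f a = y} => c a)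
    (fun i j => by rw [hcard, hcard, hc]) hu
  choose τ h1 h2 using h
  let τ' : Equiv.Perm α := (Equiv.sigmaFiberEquiv f).permCongr (Equiv.sigmaCongrRight τ)
  have hτ : ∀ y (a : {a // f a = y}), τ' a = τ y a := by
    rintro y ⟨a, rfl⟩
    rfl
  have hpow : ∀ (k : ℕ) y (a : {a // f a = y}), (τ' ^ k) a = (τ y ^ k) a := by
    intro k y a
    induction k with
    | zero => rfl
    | succ k ih => rw [pow_succ', Equiv.Perm.mul_apply, ih, hτ, pow_succ', Equiv.Perm.mul_apply]
  refine ⟨τ', fun a => ?_, fun a b hab => ?_, fun a => ?_⟩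
  · rw [hτ (f a) ⟨a, rfl⟩]
    exact (τ (f a) ⟨a, rfl⟩).2
  · obtain ⟨k, hk⟩ := h1 (f b) ⟨a, hab⟩ ⟨b, rfl⟩
    exact ⟨k, by rw [hpow k (f b) ⟨a, hab⟩, hk]⟩
  · rw [hτ (f a) ⟨a, rfl⟩]
    exact h2 (f a) ⟨a, rfl⟩

/-! ### Eigenspaces of monomial matrices as subspaces of prepartitions -/

namespace GPrepartition

variable {n N : ℕ}

/-- In each nonzero block, all residue classes modulo `d` contain the same number of labels. -/
def EvenlyColoured (d : ℕ) (P : GPrepartition n (Multiplicative (ZMod N))) : Prop :=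
  ∀ B ∈ P.part.parts, ∀ i j : ZMod d,
    (B.filter fun a => (ZMod.cast (Multiplicative.toAdd (P.label a)) : ZMod d) = i).card =
    (B.filter fun a => (ZMod.cast (Multiplicative.toAdd (P.label a)) : ZMod d) = j).card

theorem EvenlyColoured.dvd_card {d : ℕ} [NeZero d] {P : GPrepartition n (Multiplicative (ZMod N))}
    (h : P.EvenlyColoured d) {B : Finset (Fin n)} (hB : B ∈ P.part.parts) : d ∣ B.card := by
  rw [Finset.card_eq_sum_card_fiberwise
      (f := fun a => (ZMod.cast (Multiplicative.toAdd (P.label a)) : ZMod d))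
      (t := Finset.univ) (by simp),
    Finset.sum_congr rfl fun i _ => h B hB i 0]
  simp

theorem EvenlyColoured.dvd_card_compl_zero {d : ℕ} [NeZero d]
    {P : GPrepartition n (Multiplicative (ZMod N))} (h : P.EvenlyColoured d) :
    d ∣ P.zeroᶜ.card := by
  rw [← P.part.sum_card_parts]
  exact Finset.dvd_sum fun B hB => h.dvd_card hB

end GPrepartition

/-- A function on `ℤ/d` that is invariant under translation by a unit is constant. -/
theorem ZMod.eq_of_add_unit_invariant {d : ℕ} [NeZero d] {β : Type*} {f : ZMod d → β} {u : ZMod d}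
    (hu : IsUnit u) (h : ∀ i, f (i + u) = f i) (i j : ZMod d) : f i = f j := by
  have hk : ∀ k : ℕ, f (j + k * u) = f j := by
    intro k
    induction k with
    | zero => simp
    | succ k ih => rw [Nat.cast_succ, add_mul, one_mul, ← add_assoc, h, ih]
  obtain ⟨y, hy⟩ := hu.exists_left_inv
  have := hk ((i - j) * y).val
  rwa [ZMod.natCast_zmod_val, mul_assoc, hy, mul_one, add_sub_cancel] at this

/-- A property that is invariant under a permutation is constant on its cycles. -/
theorem Equiv.Perm.SameCycle.iff_of_invariant {α : Type*} [Finite α] {σ : Equiv.Perm α}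
    {p : α → Prop} (hp : ∀ j, p (σ j) ↔ p j) {i j : α} (h : σ.SameCycle i j) : p i ↔ p j := by
  obtain ⟨k, rfl⟩ := h.exists_nat_pow_eq
  induction k with
  | zero => rfl
  | succ k ih => rw [pow_succ', Equiv.Perm.mul_apply, hp]; exact ih ⟨k, by simp⟩

open GPrepartition

section

variable {n N d r : ℕ} [NeZero d] {χ : Multiplicative (ZMod N) →* ℂˣ}
  {z₀ : Multiplicative (ZMod N)} {θ : Fin n → ℂˣ} {σ : Equiv.Perm (Fin n)}

/-- The eigenspace of a monomial matrix is the subspace of an evenly coloured prepartition: the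
nonzero blocks are the cycles carrying an eigenvector, labelled by the coordinates of such a
vector, and the colour changes by a generator of `ℤ/d` along each cycle. -/
theorem exists_prepartition_of_monomialMatrix (hdN : d ∣ N)
    (hsurj : ∀ u : ℂˣ, u ^ r = 1 → ∃ g, χ g = u)
    (hker : ∀ g, χ g ^ r = 1 ↔ (ZMod.cast g.toAdd : ZMod d) = 0)
    (hz₀ : IsUnit (ZMod.cast z₀.toAdd : ZMod d)) (hθ : ∀ i, θ i ^ r = 1) :
    ∃ P : GPrepartition n (Multiplicative (ZMod N)), P.EvenlyColoured d ∧
      Module.End.eigenspace (Matrix.toLin' (monomialMatrix θ σ)) (χ z₀ : ℂ) = P.subspace χ ∧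
      ∃ t, ExistsMonomialWithoutEigenvector r (χ z₀) P.zero t ∧
        ∏ i, θ i = χ z₀ ^ P.zeroᶜ.card * t := by
  classical
  set V := Module.End.eigenspace (Matrix.toLin' (monomialMatrix θ σ)) (χ z₀ : ℂ)
  have hV : ∀ v, v ∈ V ↔ ∀ j, (θ (σ j) : ℂ) * v j = χ z₀ * v (σ j) :=
    fun v => mem_eigenspace_monomialMatrix
  have hzero : ∀ v ∈ V, ∀ j, v (σ j) = 0 ↔ v j = 0 := by
    intro v hv j
    have h := (hV v).1 hv j
    constructor
    · intro h0
      rw [h0, mul_zero] at h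
      exact (mul_eq_zero.1 h).resolve_left (Units.ne_zero _)
    · intro h0
      rw [h0, mul_zero] at h
      exact (mul_eq_zero.1 h.symm).resolve_left (Units.ne_zero _)
  let I : Finset (Fin n) := Finset.univ.filter fun i => ∀ v ∈ V, v i = 0
  have hI : ∀ i, i ∈ I ↔ ∀ v ∈ V, v i = 0 := fun i => by simp [I]
  have hIσ : ∀ j, σ j ∈ I ↔ j ∈ I := fun j => by
    rw [hI, hI]
    exact forall₂_congr fun v hv => hzero v hv j
  -- Each cycle carrying an eigenvector gets one, normalized to be `1` at a chosen point of the
  -- cycle; these are the coordinates of `w`, and all of them are values of `χ`.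
  have hf : ∀ j, ∃ v ∈ V, j ∉ I → v j ≠ 0 := by
    intro j
    by_cases hj : j ∈ I
    · exact ⟨0, V.zero_mem, fun h => absurd hj h⟩
    · rw [hI] at hj
      push Not at hj
      obtain ⟨v, hv, hvj⟩ := hj
      exact ⟨v, hv, fun _ => hvj⟩
  choose f hfV hf using hf
  let rep : Fin n → Fin n := fun i => Quotient.out (Quotient.mk (Equiv.Perm.SameCycle.setoid σ) i)
  have hrep : ∀ i, σ.SameCycle (rep i) i := fun i =>
    Quotient.exact (Quotient.out_eq (Quotient.mk (Equiv.Perm.SameCycle.setoid σ) i))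
  have hrep_eq : ∀ {i j}, σ.SameCycle i j → rep i = rep j := fun {i j} h =>
    congrArg Quotient.out (Quotient.sound (s := Equiv.Perm.SameCycle.setoid σ) h)
  have hrepI : ∀ i, rep i ∈ I ↔ i ∈ I := fun i => (hrep i).iff_of_invariant hIσ
  let w : Fin n → ℂ := fun i => f (rep i) i / f (rep i) (rep i)
  have hwσ : ∀ i, (θ (σ i) : ℂ) * w i = χ z₀ * w (σ i) := by
    intro i
    have h := (hV _).1 (hfV (rep i)) i
    simp only [w]
    rw [hrep_eq (Equiv.Perm.sameCycle_apply_left.2 (Equiv.Perm.SameCycle.refl σ i)),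
      ← mul_div_assoc, h, mul_div_assoc]
  have hw : ∀ i, ∃ g, i ∉ I → (χ g : ℂ) = w i := by
    intro i
    by_cases hi : i ∈ I
    · exact ⟨1, fun h => absurd hi h⟩
    have hinv : ∀ j, (∃ g, (χ g : ℂ) = w (σ j)) ↔ ∃ g, (χ g : ℂ) = w j := by
      intro j
      obtain ⟨h, hh⟩ := hsurj _ (hθ (σ j))
      have e := hwσ j
      rw [← hh] at e
      constructor
      · rintro ⟨g, hg⟩
        refine ⟨h⁻¹ * z₀ * g, ?_⟩
        rw [← hg] at e
        rw [map_mul, map_mul, map_inv, Units.val_mul, Units.val_mul, mul_assoc, ← e,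
          Units.inv_mul_cancel_left]
      · rintro ⟨g, hg⟩
        refine ⟨z₀⁻¹ * h * g, ?_⟩
        rw [← hg] at e
        rw [map_mul, map_mul, map_inv, Units.val_mul, Units.val_mul, mul_assoc, e,
          Units.inv_mul_cancel_left]
    obtain ⟨g, hg⟩ := ((hrep i).iff_of_invariant
      (p := fun j => ∃ g, (χ g : ℂ) = w j) hinv).1 ⟨1, by
      simp only [w]
      rw [hrep_eq (hrep i), div_self (hf _ fun h => hi ((hrepI i).1 h)), map_one, Units.val_one]⟩
    exact ⟨g, fun _ => hg⟩
  choose l hl using hw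
  have hlσ : ∀ i ∉ I, θ (σ i) * χ (l i) = χ z₀ * χ (l (σ i)) := by
    intro i hi
    apply Units.ext
    rw [Units.val_mul, Units.val_mul, hl i hi, hl (σ i) fun h => hi ((hIσ i).1 h)]
    exact hwσ i
  refine ⟨ofSetoid I (Equiv.Perm.SameCycle.setoid σ) l, ?_, ?_,
    ∏ i : I, θ i, ⟨σ.subtypePerm hIσ, fun i => θ i, fun i => hθ i, rfl, ?_⟩, ?_⟩
  · intro B hB
    obtain ⟨b, hb⟩ := Finpartition.nonempty_of_mem_parts _ hB
    have hBI : ∀ {j}, j ∈ B → j ∉ I := notMem_zero_of_mem_parts hB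
    have hBσ : ∀ j, σ j ∈ B ↔ j ∈ B := by
      intro j
      rw [← same_iff_mem hB hb, ← same_iff_mem hB hb, ofSetoid_same, ofSetoid_same, hIσ]
      exact and_congr_right fun _ => and_congr_right fun _ => Equiv.Perm.sameCycle_apply_right
    have hcol : ∀ j ∈ B, (ZMod.cast (l (σ j)).toAdd : ZMod d) + ZMod.cast z₀.toAdd =
        ZMod.cast (l j).toAdd := by
      intro j hj
      have e : χ (z₀ * l (σ j) * (l j)⁻¹) ^ r = 1 := by
        rw [map_mul, map_mul, map_inv, ← hlσ j (hBI hj), mul_inv_cancel_right, hθ]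
      rw [hker] at e
      simp only [toAdd_mul, toAdd_inv, ← ZMod.castHom_apply (h := hdN) (R := ZMod d), map_add,
        map_neg] at e ⊢
      linear_combination e
    refine ZMod.eq_of_add_unit_invariant
      (f := fun i => (B.filter fun a => (ZMod.cast (l a).toAdd : ZMod d) = i).card) hz₀ fun i => ?_
    refine Finset.card_equiv σ fun j => ?_
    rw [Finset.mem_filter, Finset.mem_filter, hBσ]
    refine and_congr_right fun hj => ?_
    rw [← hcol j hj, add_left_inj]
  · ext v
    rw [mem_subspace]
    constructor
    · refine fun hv => ⟨fun i hi => (hI i).1 hi v hv, fun i j hij => ?_⟩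
      obtain ⟨hi, hj, hc⟩ := ofSetoid_same.1 hij
      -- the quotient of the coordinates of `v` and `w` is constant on cycles
      have hq := (Equiv.Perm.SameCycle.iff_of_invariant
        (p := fun k => k ∉ I → v i * χ (l k) = v k * χ (l i)) (fun k => ?_) hc).1
        (fun _ => rfl) hj
      · exact hq
      · rw [hIσ]
        refine imp_congr_right fun hk => ?_
        have e1 : (θ (σ k) : ℂ) * χ (l k) = χ z₀ * χ (l (σ k)) := by exact_mod_cast hlσ k hk
        have e2 := (hV v).1 hv k
        constructor
        · intro h
          apply mul_left_cancel₀ (θ (σ k)).ne_zero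
          linear_combination (χ z₀ : ℂ) * h + v i * e1 - (χ (l i) : ℂ) * e2
        · intro h
          apply mul_left_cancel₀ (χ z₀).ne_zero
          linear_combination (θ (σ k) : ℂ) * h - v i * e1 + (χ (l i) : ℂ) * e2
    · rintro ⟨h1, h2⟩
      rw [hV]
      intro j
      by_cases hj : j ∈ I
      · rw [h1 j hj, h1 (σ j) ((hIσ j).2 hj), mul_zero, mul_zero]
      · have hs := h2 j (σ j) (ofSetoid_same.2 ⟨hj, fun h => hj ((hIσ j).1 h),
          Equiv.Perm.sameCycle_apply_right.2 (Equiv.Perm.SameCycle.refl σ j)⟩)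
        have e1 : (θ (σ j) : ℂ) * χ (l j) = χ z₀ * χ (l (σ j)) := by exact_mod_cast hlσ j hj
        apply mul_right_cancel₀ (χ (l j)).ne_zero
        change v j * χ (l (σ j)) = v (σ j) * χ (l j) at hs
        linear_combination v j * e1 + (χ z₀ : ℂ) * hs
  · intro v hv
    -- extended by zero, an eigenvector on `I` lies in `V`, hence vanishes on `I`
    let v' : Fin n → ℂ := fun i => if h : i ∈ I then v ⟨i, h⟩ else 0
    have hv' : v' ∈ V := by
      rw [hV]
      intro j
      by_cases hj : j ∈ I
      · have := hv ⟨j, hj⟩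
        simp only [v']
        rw [dif_pos hj, dif_pos ((hIσ j).2 hj)]
        exact this
      · simp only [v']
        rw [dif_neg hj, dif_neg fun h => hj ((hIσ j).1 h), mul_zero, mul_zero]
    funext i
    have := (hI i).1 i.2 v' hv'
    exact (dif_pos i.2).symm.trans this
  · change ∏ i, θ i = χ z₀ ^ Iᶜ.card * ∏ i : I, θ i
    rw [← Finset.prod_compl_mul_prod I, Finset.prod_coe_sort I θ]
    congr 1
    refine prod_eq_pow_card_of_eigenvector (τ := σ) (v := w) (fun j _ => hwσ j) (fun j => ?_)
      fun j hj => ?_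
    · rw [Finset.mem_compl, Finset.mem_compl, hIσ]
    · rw [← hl j (Finset.mem_compl.1 hj)]
      exact Units.ne_zero _

/-- Conversely, the subspace of an evenly coloured prepartition is an eigenspace of a monomial
matrix: on the nonzero blocks the permutation is cyclic with the colours changing by a generator
of `ℤ/d`, and on the zero block there must be no eigenvector. -/
theorem exists_monomialMatrix_of_prepartition (hdN : d ∣ N)
    (hker : ∀ g, χ g ^ r = 1 ↔ (ZMod.cast g.toAdd : ZMod d) = 0)
    (hz₀ : IsUnit (ZMod.cast z₀.toAdd : ZMod d)) {P : GPrepartition n (Multiplicative (ZMod N))}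
    (hP : P.EvenlyColoured d) {t : ℂˣ}
    (ht : ExistsMonomialWithoutEigenvector r (χ z₀) P.zero t) :
    ∃ (θ : Fin n → ℂˣ) (σ : Equiv.Perm (Fin n)), (∀ i, θ i ^ r = 1) ∧
      ∏ i, θ i = χ z₀ ^ P.zeroᶜ.card * t ∧
      Module.End.eigenspace (Matrix.toLin' (monomialMatrix θ σ)) (χ z₀ : ℂ) = P.subspace χ := by
  classical
  obtain ⟨τ₀, θ₀, h1, h2, h3⟩ := ht
  let c : Fin n → ZMod d := fun i => ZMod.cast (P.label i).toAdd
  have hpart : ∀ a : {a // ¬ a ∈ P.zero}, P.part.part a ∈ P.part.parts := fun a =>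
    P.part.part_mem.2 (Finset.mem_compl.2 a.2)
  obtain ⟨τ₁, h4, h5, h6⟩ := exists_perm_transitive_on_fibres
    (fun a : {a // ¬ a ∈ P.zero} => P.part.part a) (fun a => c a) (fun B i j => by
      by_cases hB : B ∈ P.part.parts
      · have hcard : ∀ i, (Finset.univ.filter fun a : {a // ¬ a ∈ P.zero} =>
            P.part.part a = B ∧ c a = i).card = (B.filter fun a => c a = i).card := by
          intro i
          rw [← Finset.card_map (Function.Embedding.subtype _)]
          congr 1
          ext a
          simp only [Finset.mem_map, Finset.mem_filter, Finset.mem_univ, true_and,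
            Function.Embedding.subtype_apply, Subtype.exists, exists_and_right, exists_eq_right,
            P.part.part_eq_iff_mem hB]
          exact ⟨fun h => ⟨h.1.2, h.2⟩, fun h => ⟨⟨notMem_zero_of_mem_parts hB h.1, h.1⟩, h.2⟩⟩
        rw [hcard, hcard]
        exact hP B hB i j
      · have hcard : ∀ i, (Finset.univ.filter fun a : {a // ¬ a ∈ P.zero} =>
            P.part.part a = B ∧ c a = i) = ∅ := by
          intro i
          rw [Finset.filter_eq_empty_iff]
          rintro a - ⟨h, -⟩
          exact hB (h ▸ hpart a)
        rw [hcard, hcard]) hz₀.neg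
  let σ : Equiv.Perm (Fin n) := Equiv.Perm.subtypeCongr τ₀ τ₁
  have hσ₀ : ∀ j (hj : j ∈ P.zero), σ j = τ₀ ⟨j, hj⟩ := fun j hj =>
    Equiv.Perm.subtypeCongr.left_apply _ _ hj
  have hσ₁ : ∀ j (hj : ¬ j ∈ P.zero), σ j = τ₁ ⟨j, hj⟩ := fun j hj =>
    Equiv.Perm.subtypeCongr.right_apply _ _ hj
  have hσ : ∀ j, σ j ∈ P.zero ↔ j ∈ P.zero := by
    intro j
    by_cases hj : j ∈ P.zero
    · simp only [hσ₀ j hj, hj, iff_true]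
      exact (τ₀ ⟨j, hj⟩).2
    · simp only [hσ₁ j hj, hj, iff_false]
      exact (τ₁ ⟨j, hj⟩).2
  have hsame : ∀ j ∉ P.zero, P.Same j (σ j) := by
    intro j hj
    refine ⟨P.part.part j, hpart ⟨j, hj⟩, ?_, ?_⟩
    · exact P.part.mem_part_self.2 (Finset.mem_compl.2 hj)
    · rw [hσ₁ j hj, ← h4 ⟨j, hj⟩]
      exact P.part.mem_part_self.2 (Finset.mem_compl.2 (τ₁ ⟨j, hj⟩).2)
  let θ : Fin n → ℂˣ := fun i => if h : i ∈ P.zero then θ₀ ⟨i, h⟩ else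
    χ z₀ * χ (P.label i) * (χ (P.label (σ.symm i)))⁻¹
  have hθ₀ : ∀ j (hj : j ∈ P.zero), θ j = θ₀ ⟨j, hj⟩ := fun j hj => dif_pos hj
  have hθσ : ∀ j ∉ P.zero, θ (σ j) * χ (P.label j) = χ z₀ * χ (P.label (σ j)) := by
    intro j hj
    simp only [θ]
    rw [dif_neg fun h => hj ((hσ j).1 h), σ.symm_apply_apply, inv_mul_cancel_right]
  refine ⟨θ, σ, fun i => ?_, ?_, ?_⟩
  · by_cases hi : i ∈ P.zero
    · rw [hθ₀ i hi, h1]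
    · obtain ⟨j, rfl⟩ := σ.surjective i
      have hj : j ∉ P.zero := fun h => hi ((hσ j).2 h)
      have e : θ (σ j) = χ (z₀ * P.label (σ j) * (P.label j)⁻¹) := by
        rw [map_mul, map_mul, map_inv, ← hθσ j hj, mul_inv_cancel_right]
      have hc : c (σ j) = c j - ZMod.cast z₀.toAdd := by
        rw [hσ₁ j hj, h6, ← sub_eq_add_neg]
      rw [e, hker]
      simp only [c, toAdd_mul, toAdd_inv, ← ZMod.castHom_apply (h := hdN) (R := ZMod d), map_add,
        map_neg] at hc ⊢
      linear_combination hc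
  · rw [← Finset.prod_compl_mul_prod P.zero]
    congr 1
    · refine prod_eq_pow_card_of_eigenvector (τ := σ) (v := fun i => (χ (P.label i) : ℂ))
        (fun j hj => ?_) (fun j => ?_) fun j _ => Units.ne_zero _
      · exact_mod_cast hθσ j (Finset.mem_compl.1 hj)
      · rw [Finset.mem_compl, Finset.mem_compl, hσ]
    · rw [← h2, ← Finset.prod_coe_sort]
      exact Finset.prod_congr rfl fun i _ => hθ₀ i i.2
  · ext v
    rw [mem_eigenspace_monomialMatrix, mem_subspace]
    constructor
    · intro hv
      constructor
      · intro i hi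
        have := h3 (fun i => v i) fun j => by
          have := hv j
          rw [hθ₀ (σ j) ((hσ j).2 j.2)] at this
          simp only [hσ₀ j j.2] at this
          exact this
        exact congrFun this ⟨i, hi⟩
      · rintro i j ⟨B, hB, hi, hj⟩
        have hiz := notMem_zero_of_mem_parts hB hi
        obtain ⟨k, hk⟩ := h5 ⟨i, hiz⟩ ⟨j, notMem_zero_of_mem_parts hB hj⟩ (by
          dsimp only
          rw [P.part.part_eq_of_mem hB hi, P.part.part_eq_of_mem hB hj])
        have hpow : ∀ k : ℕ, v i * χ (P.label ((τ₁ ^ k) ⟨i, hiz⟩)) =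
            v ((τ₁ ^ k) ⟨i, hiz⟩) * χ (P.label i) := by
          intro k
          induction k with
          | zero => rfl
          | succ k ih =>
            rw [pow_succ', Equiv.Perm.mul_apply]
            set x := (τ₁ ^ k) ⟨i, hiz⟩
            have e1 : (θ (σ x) : ℂ) * χ (P.label x) = χ z₀ * χ (P.label (σ x)) := by
              exact_mod_cast hθσ x x.2
            have e2 := hv x
            rw [hσ₁ x x.2] at e1 e2
            apply mul_left_cancel₀ (χ z₀).ne_zero
            linear_combination (θ (τ₁ x) : ℂ) * ih - v i * e1 + (χ (P.label i) : ℂ) * e2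
        have := hpow k
        rwa [hk] at this
    · rintro ⟨h1, h2⟩ j
      by_cases hj : j ∈ P.zero
      · rw [h1 j hj, h1 (σ j) ((hσ j).2 hj), mul_zero, mul_zero]
      · have e1 : (θ (σ j) : ℂ) * χ (P.label j) = χ z₀ * χ (P.label (σ j)) := by
          exact_mod_cast hθσ j hj
        apply mul_right_cancel₀ (χ (P.label j)).ne_zero
        linear_combination v j * e1 + (χ z₀ : ℂ) * h2 j (σ j) (hsame j hj)

end

/-- The condition on the zero block `I` of a prepartition whose subspace is an eigenspace: some
monomial map of `ℂ^I` without eigenvector completes the product of the coefficients, which is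
`z ^ (n - |I|)` on the nonzero blocks, to an element of `x μ_{r/p}`. -/
def ZeroBlockCondition {n : ℕ} (r p : ℕ) (z x : ℂˣ) (I : Finset (Fin n)) : Prop :=
  ∃ t, ExistsMonomialWithoutEigenvector r z I t ∧ (z ^ Iᶜ.card * t * x⁻¹) ^ (r / p) = 1

/-- The eigenspaces of the matrices in the coset are the subspaces of the evenly coloured
prepartitions for which the product condition can be satisfied on the zero block. -/
theorem mem_eigenspacePoset_iff {n N d r p : ℕ} [NeZero d] (hn : 0 < n)
    {χ : Multiplicative (ZMod N) →* ℂˣ} {z₀ : Multiplicative (ZMod N)} (hdN : d ∣ N)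
    (hsurj : ∀ u : ℂˣ, u ^ r = 1 → ∃ g, χ g = u)
    (hker : ∀ g, χ g ^ r = 1 ↔ (ZMod.cast g.toAdd : ZMod d) = 0)
    (hz₀ : IsUnit (ZMod.cast z₀.toAdd : ZMod d)) {x : ℂˣ} (hx : x ^ r = 1)
    {U : (Submodule ℂ (Fin n → ℂ))ᵒᵈ} :
    U ∈ eigenspacePoset (matrixCoset (diagFirst n (x : ℂ)) (imprimitiveGroup r p n)) (χ z₀ : ℂ) ↔
      ∃ P : GPrepartition n (Multiplicative (ZMod N)), P.EvenlyColoured d ∧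
        ZeroBlockCondition r p (χ z₀) x P.zero ∧ U = OrderDual.toDual (P.subspace χ) := by
  constructor
  · rintro ⟨M, hM, rfl⟩
    obtain ⟨θ, σ, h1, h2, rfl⟩ := (mem_matrixCoset_iff hn hx).1 hM
    obtain ⟨P, hP, hV, t, ht, hprod⟩ :=
      exists_prepartition_of_monomialMatrix (σ := σ) hdN hsurj hker hz₀ h1
    exact ⟨P, hP, ⟨t, ht, hprod ▸ h2⟩, by rw [hV]⟩
  · rintro ⟨P, hP, ⟨t, ht, h⟩, rfl⟩
    obtain ⟨θ, σ, h1, h2, h3⟩ := exists_monomialMatrix_of_prepartition hdN hker hz₀ hP ht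
    exact ⟨_, (mem_matrixCoset_iff hn hx).2 ⟨θ, σ, h1, h2 ▸ h, rfl⟩, by rw [h3]⟩

/-! ### Partition lattices as Dowling lattices of the trivial group -/

theorem Finpartition.part_eq_part_iff_exists {α : Type*} [DecidableEq α] {s : Finset α}
    (π : Finpartition s) {i j : α} (hi : i ∈ s) (hj : j ∈ s) :
    π.part i = π.part j ↔ ∃ B ∈ π.parts, i ∈ B ∧ j ∈ B := by
  rw [← π.mem_part_iff_part_eq_part hi hj, π.mem_part_iff_exists]

theorem Finpartition.le_iff_part_eq_part {α : Type*} [Fintype α] [DecidableEq α]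
    {π ρ : Finpartition (Finset.univ : Finset α)} :
    π ≤ ρ ↔ ∀ i j, π.part i = π.part j → ρ.part i = ρ.part j := by
  constructor
  · intro h i j hij
    rw [part_eq_part_iff_exists _ (Finset.mem_univ _) (Finset.mem_univ _)] at hij ⊢
    obtain ⟨B, hB, hi, hj⟩ := hij
    obtain ⟨C, hC, hBC⟩ := h hB
    exact ⟨C, hC, hBC hi, hBC hj⟩
  · intro h B hB
    obtain ⟨i, hi⟩ := π.nonempty_of_mem_parts hB
    refine ⟨ρ.part i, ρ.part_mem.2 (Finset.mem_univ i), fun j hj => ?_⟩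
    rw [ρ.mem_part_iff_part_eq_part (Finset.mem_univ j) (Finset.mem_univ i)]
    exact h j i ((π.part_eq_part_iff_exists (Finset.mem_univ j) (Finset.mem_univ i)).2
      ⟨B, hB, hj, hi⟩)

namespace GPrepartition

/-- The prepartition of `[k]` attached to a partition of `{0, …, k}`: the block of `0` becomes the
zero block. -/
noncomputable def ofPartition {k : ℕ} (G : Type*) [One G] (π : PartitionLattice (k + 1)) :
    GPrepartition k G :=
  ofSetoid (Finset.univ.filter fun i : Fin k => π.part i.succ = π.part 0)
    (Setoid.ker fun i : Fin k => π.part i.succ) fun _ => 1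

variable {k : ℕ} {G : Type*}

theorem mem_ofPartition_zero [One G] {π : PartitionLattice (k + 1)} {i : Fin k} :
    i ∈ (ofPartition G π).zero ↔ π.part i.succ = π.part 0 := by
  simp [ofPartition, ofSetoid]

theorem ofPartition_same [One G] {π : PartitionLattice (k + 1)} {i j : Fin k} :
    (ofPartition G π).Same i j ↔ π.part i.succ ≠ π.part 0 ∧ π.part j.succ ≠ π.part 0 ∧
      π.part i.succ = π.part j.succ := by
  rw [ofPartition, ofSetoid_same]
  simp

theorem same_iff_part_eq_part {P : GPrepartition k G} {i j : Fin k} :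
    P.Same i j ↔ i ∉ P.zero ∧ j ∉ P.zero ∧ P.part.part i = P.part.part j := by
  constructor
  · intro h
    exact ⟨h.left, h.symm.left, (P.part.part_eq_part_iff_exists (Finset.mem_compl.2 h.left)
      (Finset.mem_compl.2 h.symm.left)).2 h⟩
  · rintro ⟨hi, hj, h⟩
    exact (P.part.part_eq_part_iff_exists (Finset.mem_compl.2 hi) (Finset.mem_compl.2 hj)).1 h

theorem ofPartition_refines_iff [Group G] [Subsingleton G] {π ρ : PartitionLattice (k + 1)} :
    (ofPartition G π).Refines (ofPartition G ρ) ↔ π ≤ ρ := by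
  rw [Finpartition.le_iff_part_eq_part]
  constructor
  · rintro ⟨h1, h2⟩ i j hij
    have h0 : ∀ {i : Fin k}, π.part i.succ = π.part 0 → ρ.part i.succ = ρ.part 0 := fun {i} h =>
      mem_ofPartition_zero.1 (h1 (mem_ofPartition_zero.2 h))
    induction i using Fin.cases with
    | zero =>
      induction j using Fin.cases with
      | zero => rfl
      | succ j => exact (h0 hij.symm).symm
    | succ i =>
      induction j using Fin.cases with
      | zero => exact h0 hij
      | succ j =>
        by_cases hi : π.part i.succ = π.part 0
        · rw [h0 hi, h0 (hij.symm.trans hi)]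
        · rcases h2 i j (ofPartition_same.2 ⟨hi, hij ▸ hi, hij⟩) with ⟨hi', hj'⟩ | ⟨h, -⟩
          · rw [mem_ofPartition_zero.1 hi', mem_ofPartition_zero.1 hj']
          · exact (ofPartition_same.1 h).2.2
  · intro h
    refine ⟨fun i hi => mem_ofPartition_zero.2 (h _ _ (mem_ofPartition_zero.1 hi)),
      fun i j hij => ?_⟩
    have e := h _ _ (ofPartition_same.1 hij).2.2
    by_cases hi : ρ.part i.succ = ρ.part 0
    · exact Or.inl ⟨mem_ofPartition_zero.2 hi, mem_ofPartition_zero.2 (e.symm.trans hi)⟩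
    · exact Or.inr ⟨ofPartition_same.2 ⟨hi, e ▸ hi, e⟩, Subsingleton.elim _ _⟩

theorem exists_ofPartition_equiv [Group G] [Subsingleton G] (P : GPrepartition k G) :
    ∃ π, ofPartition G π ≈ P := by
  classical
  -- `P.part.part` is empty exactly on the zero block
  let F : Fin (k + 1) → Finset (Fin k) := Fin.cons ∅ P.part.part
  let π : PartitionLattice (k + 1) := Finpartition.ofSetoid (Setoid.ker F)
  have hπ : ∀ i j, π.part i = π.part j ↔ F i = F j := fun i j => by
    rw [← π.mem_part_iff_part_eq_part (Finset.mem_univ i) (Finset.mem_univ j),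
      Finpartition.mem_part_ofSetoid_iff_rel]
    exact eq_comm
  have hz : ∀ i : Fin k, π.part i.succ = π.part 0 ↔ i ∈ P.zero := fun i => by
    rw [hπ]
    change P.part.part i = ∅ ↔ _
    rw [P.part.part_eq_empty, Finset.mem_compl, not_not]
  refine ⟨π, equiv_of_same_iff ?_ (fun i j => ?_) fun _ _ _ => Subsingleton.elim _ _⟩
  · ext i
    rw [mem_ofPartition_zero, hz]
  · rw [ofPartition_same, same_iff_part_eq_part, hπ i.succ j.succ, ne_eq, ne_eq, hz, hz]
    rfl

end GPrepartition

/-- Adding an element to the zero block identifies `Q_k` of the trivial group with `Π_{k+1}`. -/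
theorem nonempty_dowling_orderIso_partitionLattice (k : ℕ) (G : Type*) [Group G] [Subsingleton G] :
    Nonempty (Dowling k G ≃o PartitionLattice (k + 1)) := by
  let f : PartitionLattice (k + 1) ↪o Dowling k G :=
    OrderEmbedding.ofMapLEIff (fun π => Dowling.mk (ofPartition G π)) fun _ _ =>
      Dowling.mk_le_mk.trans ofPartition_refines_iff
  refine ⟨(RelIso.ofSurjective f fun x => ?_).symm⟩
  obtain ⟨P, rfl⟩ := Dowling.exists_mk_eq x
  obtain ⟨π, hπ⟩ := exists_ofPartition_equiv P
  exact ⟨π, Quotient.sound hπ⟩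

theorem nonempty_zeroBlock_eq_empty_orderIso_partitionLattice (n : ℕ) (G : Type*) [Group G]
    [Subsingleton G] :
    Nonempty ({x : Dowling n G | x.zeroBlock = ∅} ≃o PartitionLattice n) := by
  let P : PartitionLattice n → GPrepartition n G := fun π =>
    ⟨∅, π.copy Finset.compl_empty.symm, fun _ => 1⟩
  have hP : ∀ π i j, (P π).Same i j ↔ π.part i = π.part j := fun π i j =>
    (π.part_eq_part_iff_exists (Finset.mem_univ i) (Finset.mem_univ j)).symm
  let f : PartitionLattice n ↪o Dowling n G :=
    OrderEmbedding.ofMapLEIff (fun π => Dowling.mk (P π)) fun π ρ => by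
      rw [Dowling.mk_le_mk, Finpartition.le_iff_part_eq_part]
      refine ⟨fun h i j hij => ?_, fun h => ⟨Finset.empty_subset _, fun i j hij =>
        Or.inr ⟨(hP ρ i j).2 (h i j ((hP π i j).1 hij)), Subsingleton.elim _ _⟩⟩⟩
      rcases h.2 i j ((hP π i j).2 hij) with ⟨hi, -⟩ | ⟨h, -⟩
      · exact absurd hi (Finset.notMem_empty i)
      · exact (hP ρ i j).1 h
  have hf : f '' Set.univ = {x | x.zeroBlock = ∅} := by
    ext x
    constructor
    · rintro ⟨π, -, rfl⟩
      rfl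
    · intro hx
      obtain ⟨⟨I, π, l⟩, rfl⟩ := Dowling.exists_mk_eq x
      obtain rfl : I = ∅ := hx
      exact ⟨π.copy Finset.compl_empty, trivial,
        Quotient.sound ⟨rfl, rfl, fun B _ => ⟨1, fun a _ => Subsingleton.elim _ _⟩⟩⟩
  exact (nonempty_orderIso_of_image_eq f hf).map fun e => e.trans OrderIso.Set.univ

/-! ### The condition on the zero block -/

section

variable {n r p : ℕ} {z x : ℂˣ}

theorem zeroBlockCondition_empty :
    ZeroBlockCondition r p z x (∅ : Finset (Fin n)) ↔ (z ^ n * x⁻¹) ^ (r / p) = 1 := by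
  rw [ZeroBlockCondition, Finset.compl_empty, Finset.card_univ, Fintype.card_fin]
  constructor
  · rintro ⟨t, ht, h⟩
    rwa [ht.eq_one_of_isEmpty, mul_one] at h
  · intro h
    exact ⟨1, .of_isEmpty, by rwa [mul_one]⟩

/-- If `z` is not an `r`-th root of unity, a nonempty zero block admits the product forced by the
nonzero blocks. -/
theorem zeroBlockCondition_of_pow_ne_one {I : Finset (Fin n)} (hI : I.Nonempty) (hz : z ^ r ≠ 1)
    (hzI : (z ^ Iᶜ.card) ^ r = 1) (hx : x ^ r = 1) : ZeroBlockCondition r p z x I := by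
  have := hI.to_subtype
  refine ⟨x * (z ^ Iᶜ.card)⁻¹, .of_pow_ne_one hz ?_, ?_⟩
  · rw [mul_pow, hx, inv_pow, hzI, inv_one, one_mul]
  · rw [mul_comm x, mul_inv_cancel_left, mul_inv_cancel, one_pow]

/-- Any product of coefficients other than `z ^ |I|` can be prescribed on the zero block `I`. -/
theorem zeroBlockCondition_of_ne {I : Finset (Fin n)} (hI : I.Nonempty) (hz : z ^ r = 1)
    {y : ℂˣ} (hy : y ^ r = 1) (hyx : (y * x⁻¹) ^ (r / p) = 1) (hyz : y ≠ z ^ n) :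
    ZeroBlockCondition r p z x I := by
  have := hI.to_subtype
  refine ⟨y * (z ^ Iᶜ.card)⁻¹, .of_ne_pow_card hz ?_ fun h => hyz ?_, ?_⟩
  · rw [mul_pow, hy, inv_pow, pow_right_comm, hz, one_pow, inv_one, one_mul]
  · rw [mul_inv_eq_iff_eq_mul, Fintype.card_coe, ← pow_add, Finset.card_add_card_compl,
      Fintype.card_fin] at h
    exact h
  · rwa [mul_comm y, mul_inv_cancel_left]

/-- If `z ^ n = x`, the identity of `μ_{r/p}` can be reached with a zero block of two or more
elements by cutting it into two cycles whose defects cancel. -/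
theorem zeroBlockCondition_of_two_le_card {I : Finset (Fin n)} (hI : 2 ≤ I.card) (hr : 1 < r)
    (hz : z ^ r = 1) (hzx : z ^ n = x) : ZeroBlockCondition r p z x I := by
  have hprim := Complex.isPrimitiveRoot_exp r (by omega)
  obtain ⟨w, hw⟩ := hprim.isUnit (by omega)
  rw [← hw, IsPrimitiveRoot.coe_units_iff] at hprim
  refine ⟨_, .of_eq_pow_card hz hprim.pow_eq_one (hprim.ne_one hr)
    (by rwa [Fintype.card_coe]), ?_⟩
  rw [Fintype.card_coe, ← pow_add, Finset.card_compl_add_card, Fintype.card_fin, hzx,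
    mul_inv_cancel, one_pow]

/-- If `r = p` and `z ^ n = x`, a zero block with one element would carry the coefficient `z`,
hence an eigenvector. -/
theorem not_zeroBlockCondition_of_card_eq_one {I : Finset (Fin n)} (hI : I.card = 1) (hr : 0 < r)
    (hzx : z ^ n = x) : ¬ ZeroBlockCondition r r z x I := by
  rintro ⟨t, ht, h⟩
  refine (ht.congr (β := Unit) (Fintype.equivOfCardEq (by simpa using hI))).ne_of_unique ?_
  have hn : Iᶜ.card + 1 = n := by
    have := Finset.card_compl_add_card I
    rwa [hI, Fintype.card_fin] at this
  rw [Nat.div_self hr, pow_one, mul_inv_eq_one, ← hzx] at h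
  refine mul_left_cancel (h.trans ?_)
  rw [← pow_succ]
  exact congrArg (z ^ ·) hn.symm

end

/-! ### The isomorphisms -/

/-- For `d > 1` no evenly coloured element is the minimum, whose blocks are singletons. -/
theorem dvd_one_of_mk_eq_bot {n N d : ℕ} [NeZero d] (hn : 0 < n)
    {P : GPrepartition n (Multiplicative (ZMod N))} (hP : P.EvenlyColoured d)
    (h : Dowling.mk P = ⊥) : d ∣ 1 := by
  have hb : ({⟨0, hn⟩} : Finset (Fin n)) ∈ P.part.parts := by
    have hb := congrArg Dowling.blocks h
    change P.part.parts = (⊥ : Finpartition (∅ᶜ : Finset (Fin n))).parts at hb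
    rw [hb, Finpartition.mem_bot_iff]
    exact ⟨⟨0, hn⟩, by simp, rfl⟩
  simpa using hP.dvd_card hb

theorem evenlyColoured_one {n N : ℕ} (P : GPrepartition n (Multiplicative (ZMod N))) :
    P.EvenlyColoured 1 :=
  fun B _ i j => by rw [Subsingleton.elim i j]

/-- A poset of eigenspaces is isomorphic to any set of evenly coloured elements of the Dowling
lattice that is singled out by the condition on the zero block. -/
theorem nonempty_orderIso_eigenspacePoset {r p n m d N : ℕ} [NeZero d] (hr : 0 < r) (hn : 0 < n)
    (hm : 0 < m) (hd : d = m / Nat.gcd m r) (hN : N = d * r) {z x : ℂˣ} (hz : IsPrimitiveRoot z m)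
    (hx : x ^ r = 1) {S : Set (DowlingCyclic n N)}
    (hS : ∀ y ∈ S, ∃ P : GPrepartition n (Multiplicative (ZMod N)),
      Dowling.mk P = y ∧ P.EvenlyColoured d)
    (hP : ∀ P : GPrepartition n (Multiplicative (ZMod N)), P.EvenlyColoured d →
      (Dowling.mk P ∈ S ↔ ZeroBlockCondition r p z x P.zero)) :
    Nonempty (eigenspacePoset (matrixCoset (diagFirst n (x : ℂ)) (imprimitiveGroup r p n)) z ≃o
      S) := by
  obtain ⟨χ, z₀, hχ, hsurj, hker, rfl, hz₀⟩ := exists_rootsOfUnity_labelling hr hm hd hN hz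
  refine nonempty_orderIso_of_image_eq (Dowling.subspaceEmbedding χ hχ) (Set.ext fun U => ?_)
  rw [mem_eigenspacePoset_iff hn (hN ▸ Dvd.intro r rfl) hsurj hker hz₀ hx]
  constructor
  · rintro ⟨y, hy, rfl⟩
    obtain ⟨P, rfl, hPe⟩ := hS y hy
    exact ⟨P, hPe, (hP P hPe).1 hy, Dowling.subspaceEmbedding_mk χ hχ P⟩
  · rintro ⟨P, hPe, h, rfl⟩
    exact ⟨Dowling.mk P, (hP P hPe).2 h, Dowling.subspaceEmbedding_mk χ hχ P⟩

/-- For `d > 1` a nonempty zero block meets no obstruction. -/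
theorem zeroBlockCondition_iff_of_one_lt {r p n m d N : ℕ} [NeZero d] (hm : 0 < m)
    (hd : d = m / Nat.gcd m r) (hd1 : 1 < d) {z x : ℂˣ} (hz : IsPrimitiveRoot z m)
    (hx : x ^ r = 1) {P : GPrepartition n (Multiplicative (ZMod N))} (hP : P.EvenlyColoured d) :
    ZeroBlockCondition r p z x P.zero ↔ (P.zero.card = 0 → (z ^ n * x⁻¹) ^ (r / p) = 1) := by
  have hmd : m = d * Nat.gcd m r := by rw [hd, Nat.div_mul_cancel (Nat.gcd_dvd_left m r)]
  rcases P.zero.eq_empty_or_nonempty with h | h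
  · rw [h, zeroBlockCondition_empty]
    simp
  · refine iff_of_true (zeroBlockCondition_of_pow_ne_one h (fun hzr => ?_) ?_ hx)
      fun h0 => absurd h0 h.card_ne_zero
    · rw [hz.pow_eq_one_iff_dvd] at hzr
      rw [Nat.gcd_eq_left hzr, Nat.div_self hm] at hd
      omega
    · obtain ⟨k, hk⟩ := hP.dvd_card_compl_zero
      rw [← pow_mul, hz.pow_eq_one_iff_dvd, hk, mul_right_comm]
      refine Dvd.dvd.mul_right ?_ k
      nth_rewrite 1 [hmd]
      exact Nat.mul_dvd_mul_left d (Nat.gcd_dvd_right m r)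

theorem mainTheorem1 (r p n e m d : ℕ) (ξ ζ : ℂ)
    (hr : 0 < r) (hp : p ∣ r) (hn : 0 < n) (he : e ∣ p)
    (hξ : IsPrimitiveRoot ξ (e * r / p))
    (hm : 0 < m) (hζ : IsPrimitiveRoot ζ m) (hd : d = m / Nat.gcd m r) :
    -- (i)
    (1 < d → d ∣ n → (ζ ^ n * ξ⁻¹) ^ (r / p) ≠ 1 →
      Nonempty (eigenspacePoset (matrixCoset (diagFirst n ξ) (imprimitiveGroup r p n)) ζ ≃o
        (dowlingDivEvenJ n (d * r) d d {0} \ {⊥} : Set (DowlingCyclic n (d * r))))) ∧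
    -- (ii)
    (1 < d → ¬ (d ∣ n ∧ (ζ ^ n * ξ⁻¹) ^ (r / p) ≠ 1) →
      Nonempty (eigenspacePoset (matrixCoset (diagFirst n ξ) (imprimitiveGroup r p n)) ζ ≃o
        (dowlingDivEven n (d * r) d d \ {⊥} : Set (DowlingCyclic n (d * r))))) ∧
    -- (iii)
    (d = 1 → (ζ ^ n * ξ⁻¹) ^ (r / p) ≠ 1 →
      Nonempty (eigenspacePoset (matrixCoset (diagFirst n ξ) (imprimitiveGroup r p n)) ζ ≃o
        (dowlingJ n r {0} \ {⊥} : Set (DowlingCyclic n r)))) ∧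
    -- (iv)
    (d = 1 → r = p → r ≠ 1 → ζ ^ n = ξ →
      Nonempty (eigenspacePoset (matrixCoset (diagFirst n ξ) (imprimitiveGroup r p n)) ζ ≃o
        dowlingJ n r {1})) ∧
    -- (v)
    (d = 1 → r = p → r = 1 →
      m = 1 ∧
      Nonempty (eigenspacePoset (matrixCoset (diagFirst n ξ) (imprimitiveGroup r p n)) ζ ≃o
        DowlingCyclic (n - 1) 1) ∧
      Nonempty (DowlingCyclic (n - 1) 1 ≃o PartitionLattice n)) ∧
    -- (vi)
    (d = 1 → ¬ ((ζ ^ n * ξ⁻¹) ^ (r / p) ≠ 1) → ¬ (r = p ∧ r ≠ 1 ∧ ζ ^ n = ξ) →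
      ¬ (r = p ∧ r = 1) →
      Nonempty (eigenspacePoset (matrixCoset (diagFirst n ξ) (imprimitiveGroup r p n)) ζ ≃o
        DowlingCyclic n r)) := by
  have hp0 : 0 < p := Nat.pos_of_dvd_of_pos hp hr
  have hξr : ξ ^ r = 1 := by
    rw [hξ.pow_eq_one_iff_dvd]
    obtain ⟨a, rfl⟩ := hp
    obtain ⟨b, rfl⟩ := he
    refine ⟨b, ?_⟩
    rw [mul_left_comm, Nat.mul_div_cancel_left _ hp0]
    ring
  obtain ⟨z, rfl⟩ := hζ.isUnit hm.ne'
  obtain ⟨x, rfl⟩ := IsUnit.of_pow_eq_one hξr hr.ne'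
  rw [IsPrimitiveRoot.coe_units_iff] at hζ
  have hx : x ^ r = 1 := by
    apply Units.ext
    rw [Units.val_pow_eq_pow_val, hξr, Units.val_one]
  have hcond : ((z : ℂ) ^ n * (x : ℂ)⁻¹) ^ (r / p) = 1 ↔ (z ^ n * x⁻¹) ^ (r / p) = 1 := by
    rw [← Units.val_inj]
    simp
  have hzn : (z : ℂ) ^ n = x ↔ z ^ n = x := by
    rw [← Units.val_inj]
    simp
  rw [ne_eq, hcond, hzn]
  have hd0 : 0 < d := by
    rw [hd]
    exact Nat.div_pos (Nat.le_of_dvd hm (Nat.gcd_dvd_left m r)) (Nat.gcd_pos_of_pos_left r hm)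
  have : NeZero d := ⟨hd0.ne'⟩
  have hz1 : d = 1 → z ^ r = 1 := by
    intro h1
    rw [hζ.pow_eq_one_iff_dvd]
    have := Nat.div_mul_cancel (Nat.gcd_dvd_left m r)
    rw [← hd, h1, one_mul] at this
    exact this ▸ Nat.gcd_dvd_right m r
  -- the elements of `Q_n(dr, d, d) ∖ {0̂}` are those with an evenly coloured representative
  have heven : ∀ y ∈ (dowlingDivEven n (d * r) d d \ {⊥} : Set (DowlingCyclic n (d * r))),
      ∃ P : GPrepartition n (Multiplicative (ZMod (d * r))),
        Dowling.mk P = y ∧ P.EvenlyColoured d := by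
    rintro y ⟨⟨-, hy⟩ | hy, hy'⟩
    · exact hy
    · exact absurd hy hy'
  have hmem : 1 < d → ∀ P : GPrepartition n (Multiplicative (ZMod (d * r))),
      P.EvenlyColoured d → Dowling.mk P ∈ dowlingDivEven n (d * r) d d ∧ Dowling.mk P ≠ ⊥ :=
    fun hd1 P hP => ⟨Or.inl ⟨Or.inl fun B hB => hP.dvd_card hB, P, rfl, hP⟩, fun h =>
      hd1.ne' (Nat.dvd_one.1 (dvd_one_of_mk_eq_bot hn hP h))⟩
  refine ⟨fun hd1 hdn hne => ?_, fun hd1 hne => ?_, fun hd1 hne => ?_, fun hd1 hrp hr1 hzx => ?_,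
    fun hd1 hrp hr1 => ?_, fun hd1 heq h4 h5 => ?_⟩
  · refine nonempty_orderIso_eigenspacePoset hr hn hm hd rfl hζ hx (fun y hy => ?_)
      fun P hP => ?_
    · obtain ⟨⟨hy, -⟩ | hy, hy'⟩ := hy
      · exact heven y ⟨hy, hy'⟩
      · exact absurd hy hy'
    · rw [zeroBlockCondition_iff_of_one_lt hm hd hd1 hζ hx hP]
      obtain ⟨h1, h2⟩ := hmem hd1 P hP
      constructor
      · rintro ⟨⟨-, h⟩ | h, -⟩ h0
        · exact absurd h0 h
        · exact absurd h h2
      · intro h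
        exact ⟨Or.inl ⟨h1, fun h0 => hne (h h0)⟩, h2⟩
  · refine nonempty_orderIso_eigenspacePoset hr hn hm hd rfl hζ hx heven fun P hP => ?_
    rw [zeroBlockCondition_iff_of_one_lt hm hd hd1 hζ hx hP]
    refine iff_of_true (hmem hd1 P hP) fun h0 => ?_
    by_contra h
    refine hne ⟨?_, h⟩
    have hc := Finset.card_compl_add_card P.zero
    rw [h0, add_zero, Fintype.card_fin] at hc
    exact hc ▸ hP.dvd_card_compl_zero
  · subst hd1
    refine nonempty_orderIso_eigenspacePoset hr hn hm hd (one_mul r).symm hζ hx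
      (fun y _ => (Dowling.exists_mk_eq y).imp fun P h => ⟨h, evenlyColoured_one P⟩) fun P _ => ?_
    constructor
    · rintro ⟨h | h, h'⟩
      · -- one cycle on the zero block, with total product `x`
        refine zeroBlockCondition_of_ne (y := x) ?_ (hz1 rfl) hx ?_ fun h => hne ?_
        · exact Finset.card_ne_zero.1 h
        · rw [mul_inv_cancel, one_pow]
        · rw [← h, mul_inv_cancel, one_pow]
      · exact absurd h h'
    · intro h
      have h0 : P.zero.card ≠ 0 := fun h0 => hne (by
        rw [Finset.card_eq_zero.1 h0] at h
        exact zeroBlockCondition_empty.1 h)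
      refine ⟨Or.inl h0, fun hb => h0 ?_⟩
      exact congrArg (fun y => (Dowling.zeroBlock y).card) hb
  · subst hd1 hrp
    refine nonempty_orderIso_eigenspacePoset hr hn hm hd (one_mul r).symm hζ hx
      (fun y _ => (Dowling.exists_mk_eq y).imp fun P h => ⟨h, evenlyColoured_one P⟩) fun P _ => ?_
    constructor
    · intro h
      have h1 : P.zero.card ≠ 1 := by
        rcases h with h | h
        · exact h
        · have : P.zero.card = 0 := congrArg (fun y => (Dowling.zeroBlock y).card) h
          omega
      by_cases h0 : P.zero.card = 0
      · rw [Finset.card_eq_zero.1 h0, zeroBlockCondition_empty, hzx, mul_inv_cancel, one_pow]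
      · exact zeroBlockCondition_of_two_le_card (by omega) (by omega) (hz1 rfl) hzx
    · exact fun h => Or.inl fun h1 => not_zeroBlockCondition_of_card_eq_one h1 hr hzx h
  · subst hd1 hrp hr1
    have hz : z = 1 := by simpa using hz1 rfl
    have hx1 : x = 1 := by simpa using hx
    have hm1 : m = 1 := by simpa using hd.symm
    obtain ⟨k, rfl⟩ : ∃ k, n = k + 1 := ⟨n - 1, by omega⟩
    obtain ⟨e₁⟩ := nonempty_dowling_orderIso_partitionLattice k (Multiplicative (ZMod 1))
    obtain ⟨e₂⟩ := nonempty_zeroBlock_eq_empty_orderIso_partitionLattice (k + 1)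
      (Multiplicative (ZMod 1))
    refine ⟨hm1, ?_, ⟨e₁⟩⟩
    refine (nonempty_orderIso_eigenspacePoset hr hn hm hd (one_mul 1).symm hζ hx
      (S := {y | y.zeroBlock = ∅})
      (fun y _ => (Dowling.exists_mk_eq y).imp fun P h => ⟨h, evenlyColoured_one P⟩)
      fun P _ => ?_).map fun e₃ => (e₃.trans e₂).trans e₁.symm
    constructor
    · intro h
      rw [show P.zero = ∅ from h, zeroBlockCondition_empty, hz, hx1]
      simp
    · rintro ⟨t, ht, -⟩
      rw [hz] at ht
      exact Finset.isEmpty_coe_sort.1 ht.isEmpty_of_one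
  · subst hd1
    rw [not_not] at heq
    have hq : 1 < r / p := by
      by_contra hq
      have hq1 : r / p = 1 := le_antisymm (not_lt.1 hq)
        (Nat.div_pos (Nat.le_of_dvd hr hp) hp0)
      have hrp : r = p := by
        have := Nat.div_mul_cancel hp
        rw [hq1, one_mul] at this
        exact this.symm
      rw [hq1, pow_one, mul_inv_eq_one] at heq
      by_cases hr1 : r = 1
      · exact h5 ⟨hrp, hr1⟩
      · exact h4 ⟨hrp, hr1, heq⟩
    refine (nonempty_orderIso_eigenspacePoset hr hn hm hd (one_mul r).symm hζ hx
      (S := Set.univ)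
      (fun y _ => (Dowling.exists_mk_eq y).imp fun P h => ⟨h, evenlyColoured_one P⟩)
      fun P _ => ?_).map fun e => e.trans OrderIso.Set.univ
    refine iff_of_true trivial ?_
    rcases P.zero.eq_empty_or_nonempty with h | h
    · rw [h, zeroBlockCondition_empty]
      exact heq
    · -- multiply `z ^ n` by a nontrivial element of `μ_{r/p}`
      have hprim := Complex.isPrimitiveRoot_exp (r / p) (by omega)
      obtain ⟨w, hw⟩ := hprim.isUnit (by omega)
      rw [← hw, IsPrimitiveRoot.coe_units_iff] at hprim
      refine zeroBlockCondition_of_ne (y := w * z ^ n) h (hz1 rfl) ?_ ?_ ?_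
      · rw [mul_pow, pow_right_comm, hz1 rfl, one_pow, mul_one]
        exact (hprim.pow_eq_one_iff_dvd r).2 (Nat.div_dvd_of_dvd hp)
      · rw [mul_assoc, mul_pow, heq, hprim.pow_eq_one, one_mul]
      · intro h
        exact hprim.ne_one hq (mul_eq_right.1 h)
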